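/- Let $\theta\in\mathbb{R}$ and $\tau\in\mathbb{C}\setminus\mathbb{R}$. Let $A_\theta$ be the algebra of series $a=\sum_{(m,n)\in\mathbb{Z}^2}a_{m,n}U_1^mU_2^n$ with rapidly decreasing coefficients $a_{m,n}\in\mathbb{C}$, where $U_1U_2=e^{2\pi i\theta}U_2U_1$, with its Fréchet topology; let $\delta_\tau\big(\sum a_{m,n}U_1^mU_2^n\big)=2\pi i\sum(m\tau+n)a_{m,n}U_1^mU_2^n$, $\operatorname{tr}(a)=a_{0,0}$ and $H=\{a\in A_\theta:\operatorname{tr}(a)=0\}$. For $a\in H$ put $\operatorname{ad}(a)x=ax-xa$ and $d_a=\delta_\tau+\operatorname{ad}(a):A_\theta\to A_\theta$, and let $$\Theta_\tau=\{a\in H:\ \dim\ker(d_a)>1\}.$$ For $s\in\mathbb{Z}$ let $W_s(H)$ be the Hilbert space of series $x=\sum_{(m,n)\neq(0,0)}x_{m,n}U_1^mU_2^n$ with $\|x\|_s^2=\sum(1+|2\pi i(m\tau+n)|^2)^s|x_{m,n}|^2<\infty$. Let $\mathcal{F}_0$ be the space of bounded Fredholm operators $T:W_0(H)\to W_{-1}(H)$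 of index zero. Quillen's determinant line bundle $\mathcal{L}$ on $\mathcal{F}_0$ is the holomorphic line bundle that is trivial over each of the sets $\mathcal{U}_A=\{T:\ T+A\text{ is invertible}\}$, where $A:W_0(H)\to W_{-1}(H)$ is of trace class, with transition functions $g_{A,B}(T)=\det_F(1+(A-B)(T+B)^{-1})$, where $\det_F$ is the Fredholm determinant. It has a canonical holomorphic section $s$, given over $\mathcal{U}_A$ by $s_A(T)=\det_F(1-(T+A)^{-1}A)$, where $s_B=g_{A,B}s_A$. The operators $\delta_\tau$, $\operatorname{ad}(a)$ and $d_a$ (for $a\in H$) map $H$ to $H$ and extend to bounded operators $W_0(H)\to W_{-1}(H)$, denoted by the same symbols; $d_a\in\mathcal{F}_0$ and the map $H\to\mathcal{F}_0$, $a\mapsto d_a$, is holomorphic. Moreover: (i) The subset $\Theta_\tau\subset H$ coincides with the zero locus of the global holomorphic section $a\mapsto s(d_a)$ of the pull-back of $\mathcal{L}$ to $H$ under $a\mapsto d_a$. (ii) For every one-dimensional subspace $L\subset H$ the intersection $\Theta_\tau\cap L$ is a discrete subset of $L\setminus\{0\}$: it does not contain $0$ and has no accumulation point in $L$. Furthermore,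 $\delta_\tau:W_0(H)\to W_{-1}(H)$ is an isomorphism, for every $a\in H$ the operator $\delta_\tau^{-1}\operatorname{ad}(a):W_0(H)\to W_0(H)$ is compact, and for every $t\in\mathbb{C}\setminus\{0\}$ one has $ta\in\Theta_\tau$ if and only if $-t^{-1}$ belongs to the spectrum of $\delta_\tau^{-1}\operatorname{ad}(a)$. -/

import Mathlib

open Filter Topology

noncomputable section

/-! ### The algebra of smooth functions on the noncommutative two-torus -/

namespace NCTorus

/-- The size `1 + |m| + |n|` of a lattice vector `(m, n)`. -/
def size (v : ℤ × ℤ) : ℝ := 1 + |(v.1 : ℝ)| + |(v.2 : ℝ)|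

lemma one_le_size (v : ℤ × ℤ) : 1 ≤ size v := by
  have h1 := abs_nonneg (v.1 : ℝ)
  have h2 := abs_nonneg (v.2 : ℝ)
  unfold size; linarith

lemma size_pos (v : ℤ × ℤ) : 0 < size v := lt_of_lt_of_le one_pos (one_le_size v)

lemma size_add_le (v w : ℤ × ℤ) : size (v + w) ≤ size v * size w := by
  have h1 := abs_nonneg (v.1 : ℝ)
  have h2 := abs_nonneg (v.2 : ℝ)
  have h3 := abs_nonneg (w.1 : ℝ)
  have h4 := abs_nonneg (w.2 : ℝ)
  have h5 := abs_add_le (v.1 : ℝ) (w.1 : ℝ)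
  have h6 := abs_add_le (v.2 : ℝ) (w.2 : ℝ)
  simp only [size, Prod.fst_add, Prod.snd_add, Int.cast_add]
  nlinarith [mul_nonneg h1 h3, mul_nonneg h1 h4, mul_nonneg h2 h3, mul_nonneg h2 h4]

lemma summable_size_inv : Summable (fun v : ℤ × ℤ => (size v ^ 4)⁻¹) := by
  have h1 : Summable (fun m : ℤ => ((1 + |(m : ℝ)|) ^ 2)⁻¹) := by
    have h0 : Summable (fun m : ℤ => |(m : ℝ)| ^ (-2 : ℝ)) :=
      Real.summable_abs_int_rpow (by norm_num)
    refine Summable.of_norm_bounded_eventually h0 ?_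
    have hfin : ({0}ᶜ : Set ℤ) ∈ (cofinite : Filter ℤ) :=
      (Set.finite_singleton 0).compl_mem_cofinite
    filter_upwards [hfin] with m hm
    have hm' : (m : ℝ) ≠ 0 := by exact_mod_cast hm
    have hpos : 0 < |(m : ℝ)| := abs_pos.mpr hm'
    rw [Real.norm_of_nonneg (by positivity), Real.rpow_neg hpos.le]
    norm_num only [Real.rpow_ofNat]
    gcongr
    linarith
  have h2 : Summable (fun v : ℤ × ℤ =>
      ((1 + |(v.1 : ℝ)|) ^ 2)⁻¹ * ((1 + |(v.2 : ℝ)|) ^ 2)⁻¹) :=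
    h1.mul_of_nonneg h1 (fun _ => by positivity) (fun _ => by positivity)
  refine Summable.of_nonneg_of_le (fun v => by have := size_pos v; positivity) (fun v => ?_) h2
  rw [← mul_inv]
  have ha := abs_nonneg (v.1 : ℝ)
  have hb := abs_nonneg (v.2 : ℝ)
  have h3 : (1 + |(v.1 : ℝ)|) ≤ size v := by unfold size; linarith
  have h4 : (1 + |(v.2 : ℝ)|) ≤ size v := by unfold size; linarith
  have h5 : (1 + |(v.1 : ℝ)|) ^ 2 * (1 + |(v.2 : ℝ)|) ^ 2 ≤ size v ^ 4 := by
    calc (1 + |(v.1 : ℝ)|) ^ 2 * (1 + |(v.2 : ℝ)|) ^ 2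
        ≤ size v ^ 2 * size v ^ 2 := by gcongr
      _ = size v ^ 4 := by ring
  exact inv_anti₀ (by positivity) h5

/-- Families of complex numbers indexed by `ℤ²` that decrease rapidly at infinity. -/
def rapidlyDecreasing : Submodule ℂ (ℤ × ℤ → ℂ) where
  carrier := {a | ∀ k : ℕ, ∃ C : ℝ, ∀ v, size v ^ k * ‖a v‖ ≤ C}
  zero_mem' := fun k => ⟨0, fun v => by simp⟩
  add_mem' := by
    intro a b ha hb k
    obtain ⟨C, hC⟩ := ha k
    obtain ⟨D, hD⟩ := hb k
    refine ⟨C + D, fun v => ?_⟩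
    have h := norm_add_le (a v) (b v)
    have hs : 0 ≤ size v ^ k := pow_nonneg (size_pos v).le k
    calc size v ^ k * ‖(a + b) v‖ ≤ size v ^ k * (‖a v‖ + ‖b v‖) := by
            exact mul_le_mul_of_nonneg_left h hs
      _ ≤ C + D := by rw [mul_add]; exact add_le_add (hC v) (hD v)
  smul_mem' := by
    intro c a ha k
    obtain ⟨C, hC⟩ := ha k
    refine ⟨‖c‖ * C, fun v => ?_⟩
    calc size v ^ k * ‖(c • a) v‖ = ‖c‖ * (size v ^ k * ‖a v‖) := by
            simp only [Pi.smul_apply, norm_smul]; ring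
      _ ≤ ‖c‖ * C := mul_le_mul_of_nonneg_left (hC v) (norm_nonneg c)

end NCTorus

open NCTorus in
/-- The algebra `A_θ` of smooth functions on the noncommutative torus. An element is given by the
rapidly decreasing family `(a_{m,n})` of coefficients of the series `∑ a_{m,n} U₁^m U₂^n`. -/
def SmoothNCTorus (_θ : ℝ) : Type := rapidlyDecreasing

namespace SmoothNCTorus

open NCTorus

variable {θ : ℝ}

instance : AddCommGroup (SmoothNCTorus θ) := inferInstanceAs (AddCommGroup rapidlyDecreasing)
instance : Module ℂ (SmoothNCTorus θ) := inferInstanceAs (Module ℂ rapidlyDecreasing)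
instance : FunLike (SmoothNCTorus θ) (ℤ × ℤ) ℂ where
  coe a := a.1
  coe_injective := Subtype.val_injective

@[ext] lemma ext {a b : SmoothNCTorus θ} (h : ∀ v, a v = b v) : a = b := DFunLike.ext a b h

@[simp] lemma add_apply (a b : SmoothNCTorus θ) (v : ℤ × ℤ) : (a + b) v = a v + b v := rfl
@[simp] lemma smul_apply (c : ℂ) (a : SmoothNCTorus θ) (v : ℤ × ℤ) : (c • a) v = c * a v := rfl
@[simp] lemma zero_apply (v : ℤ × ℤ) : (0 : SmoothNCTorus θ) v = 0 := rfl

lemma decay (a : SmoothNCTorus θ) (k : ℕ) : ∃ C : ℝ, ∀ v, size v ^ k * ‖a v‖ ≤ C := a.2 k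

lemma summable_weighted (a : SmoothNCTorus θ) (k : ℕ) :
    Summable (fun v => size v ^ k * ‖a v‖) := by
  obtain ⟨C, hC⟩ := a.decay (k + 4)
  refine Summable.of_nonneg_of_le
    (fun v => mul_nonneg (pow_nonneg (size_pos v).le k) (norm_nonneg _)) (fun v => ?_)
    (summable_size_inv.mul_left C)
  have hs := size_pos v
  have h := hC v
  rw [← div_eq_mul_inv, le_div_iff₀ (by positivity)]
  calc size v ^ k * ‖a v‖ * size v ^ 4 = size v ^ (k + 4) * ‖a v‖ := by ring
    _ ≤ C := h

/-- The cocycle `exp (-2πiθ n m')`, which comes from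
`U₁^m U₂^n U₁^m' U₂^n' = exp (-2πiθ n m') U₁^(m+m') U₂^(n+n')`, a form of the relation
`U₁ U₂ = exp (2πiθ) U₂ U₁`. -/
def phase (θ : ℝ) (v w : ℤ × ℤ) : ℂ :=
  Complex.exp (-(2 * Real.pi * Complex.I * θ * v.2 * w.1))

lemma norm_phase (θ : ℝ) (v w : ℤ × ℤ) : ‖phase θ v w‖ = 1 := by
  have h : -(2 * Real.pi * Complex.I * θ * v.2 * w.1) =
      ((-(2 * Real.pi * θ * v.2 * w.1) : ℝ) : ℂ) * Complex.I := by
    push_cast; ring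
  rw [phase, h, Complex.norm_exp_ofReal_mul_I]

lemma norm_term (a b : SmoothNCTorus θ) (v w : ℤ × ℤ) :
    ‖a v * b (w - v) * phase θ v (w - v)‖ = ‖a v‖ * ‖b (w - v)‖ := by
  rw [norm_mul, norm_mul, norm_phase, mul_one]

lemma term_bound (a b : SmoothNCTorus θ) (k : ℕ) : ∃ C : ℝ, ∀ v w : ℤ × ℤ,
    size w ^ k * ‖a v * b (w - v) * phase θ v (w - v)‖ ≤ C * (size v ^ k * ‖a v‖) := by
  obtain ⟨C, hC⟩ := b.decay k
  refine ⟨C, fun v w => ?_⟩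
  rw [norm_term]
  have h1 : size w ≤ size v * size (w - v) := by
    simpa using size_add_le v (w - v)
  have h2 : size w ^ k ≤ size v ^ k * size (w - v) ^ k := by
    rw [← mul_pow]; exact pow_le_pow_left₀ (size_pos w).le h1 k
  have h3 : 0 ≤ ‖a v‖ * ‖b (w - v)‖ := by positivity
  have h4 : 0 ≤ size v ^ k * ‖a v‖ := mul_nonneg (pow_nonneg (size_pos v).le k) (norm_nonneg _)
  calc size w ^ k * (‖a v‖ * ‖b (w - v)‖)
      ≤ size v ^ k * size (w - v) ^ k * (‖a v‖ * ‖b (w - v)‖) :=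
        mul_le_mul_of_nonneg_right h2 h3
    _ = (size (w - v) ^ k * ‖b (w - v)‖) * (size v ^ k * ‖a v‖) := by ring
    _ ≤ C * (size v ^ k * ‖a v‖) := mul_le_mul_of_nonneg_right (hC _) h4

lemma summable_term (a b : SmoothNCTorus θ) (w : ℤ × ℤ) :
    Summable (fun v => a v * b (w - v) * phase θ v (w - v)) := by
  obtain ⟨C, hC⟩ := term_bound a b 0
  refine Summable.of_norm_bounded ((a.summable_weighted 0).mul_left C) (fun v => ?_)
  simpa using hC v w

/-- The product of `A_θ`, computed coefficientwise from
`U₁^m U₂^n U₁^m' U₂^n' = exp (-2πiθ n m') U₁^(m+m') U₂^(n+n')`. -/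
instance : Mul (SmoothNCTorus θ) where
  mul a b := ⟨fun w => ∑' v, a v * b (w - v) * phase θ v (w - v), by
    intro k
    obtain ⟨C, hC⟩ := term_bound a b k
    refine ⟨C * ∑' v, size v ^ k * ‖a v‖, fun w => ?_⟩
    have hk : 0 < size w ^ k := pow_pos (size_pos w) k
    have hs := (summable_term a b w).norm
    calc size w ^ k * ‖∑' v, a v * b (w - v) * phase θ v (w - v)‖
        ≤ size w ^ k * ∑' v, ‖a v * b (w - v) * phase θ v (w - v)‖ :=
          mul_le_mul_of_nonneg_left (norm_tsum_le_tsum_norm hs) hk.le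
      _ = ∑' v, size w ^ k * ‖a v * b (w - v) * phase θ v (w - v)‖ := tsum_mul_left.symm
      _ ≤ ∑' v, C * (size v ^ k * ‖a v‖) :=
          Summable.tsum_le_tsum (fun v => hC v w) (hs.mul_left _)
            ((a.summable_weighted k).mul_left C)
      _ = C * ∑' v, size v ^ k * ‖a v‖ := tsum_mul_left⟩

lemma mul_apply (a b : SmoothNCTorus θ) (w : ℤ × ℤ) :
    (a * b) w = ∑' v, a v * b (w - v) * phase θ v (w - v) := rfl

instance : NonUnitalNonAssocRing (SmoothNCTorus θ) where
  left_distrib a b c := by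
    ext w
    rw [add_apply, mul_apply, mul_apply, mul_apply,
      ← (summable_term a b w).tsum_add (summable_term a c w)]
    exact tsum_congr fun v => by rw [add_apply]; ring
  right_distrib a b c := by
    ext w
    rw [add_apply, mul_apply, mul_apply, mul_apply,
      ← (summable_term a c w).tsum_add (summable_term b c w)]
    exact tsum_congr fun v => by rw [add_apply]; ring
  zero_mul a := by
    ext w
    rw [mul_apply]
    simp
  mul_zero a := by
    ext w
    rw [mul_apply]
    simp

instance : IsScalarTower ℂ (SmoothNCTorus θ) (SmoothNCTorus θ) where
  smul_assoc c a b := by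
    ext w
    simp only [smul_eq_mul, mul_apply, smul_apply]
    rw [← tsum_mul_left]
    exact tsum_congr fun v => by ring

instance : SMulCommClass ℂ (SmoothNCTorus θ) (SmoothNCTorus θ) where
  smul_comm c a b := by
    ext w
    simp only [smul_eq_mul, mul_apply, smul_apply]
    rw [← tsum_mul_left]
    exact tsum_congr fun v => by ring

/-- The weighted family `((1 + |m| + |n|)^k a_{m,n})`, as an element of `ℓ^∞(ℤ²)`. -/
def weighted (k : ℕ) (a : SmoothNCTorus θ) : lp (fun _ : ℤ × ℤ => ℂ) ⊤ :=
  ⟨fun v => (size v ^ k : ℝ) • a v, by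
    obtain ⟨C, hC⟩ := a.decay k
    refine memℓp_infty ⟨C, ?_⟩
    rintro _ ⟨v, rfl⟩
    have hs : 0 ≤ size v ^ k := pow_nonneg (size_pos v).le k
    simpa [norm_smul, abs_of_nonneg (size_pos v).le] using hC v⟩

/-- The Fréchet topology of `A_θ`, given by the norms `sup (1 + |m| + |n|)^k |a_{m,n}|`,
`k = 0, 1, 2, …`. -/
instance : TopologicalSpace (SmoothNCTorus θ) :=
  ⨅ k : ℕ, TopologicalSpace.induced (weighted k) inferInstance

end SmoothNCTorus

namespace NCTorus

/-- The eigenvalue `2πi(mτ + n)` of `δ_τ` on `U₁^m U₂^n`. -/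
def iota (τ : ℂ) (v : ℤ × ℤ) : ℂ := 2 * Real.pi * Complex.I * (v.1 * τ + v.2)

lemma exists_norm_iota_le (τ : ℂ) : ∃ C : ℝ, 1 ≤ C ∧ ∀ v, ‖iota τ v‖ ≤ C * size v := by
  refine ⟨2 * Real.pi * (‖τ‖ + 1), ?_, fun v => ?_⟩
  · have := Real.pi_gt_three
    nlinarith [norm_nonneg τ]
  · have h1 := abs_nonneg (v.1 : ℝ)
    have h2 := abs_nonneg (v.2 : ℝ)
    have h3 : ‖(v.1 : ℂ) * τ + v.2‖ ≤ |(v.1 : ℝ)| * ‖τ‖ + |(v.2 : ℝ)| := by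
      refine (norm_add_le _ _).trans ?_
      rw [norm_mul, Complex.norm_intCast, Complex.norm_intCast]
    have hpi := Real.pi_pos
    have h4 : ‖(v.1 : ℂ) * τ + v.2‖ ≤ (‖τ‖ + 1) * size v := by
      refine h3.trans ?_
      unfold size
      nlinarith [norm_nonneg τ, mul_nonneg (norm_nonneg τ) h2]
    have h5 : ‖iota τ v‖ = 2 * Real.pi * ‖(v.1 : ℂ) * τ + v.2‖ := by
      rw [iota, norm_mul]
      congr 1
      simp [abs_of_pos hpi]
    rw [h5]
    exact (mul_le_mul_of_nonneg_left h4 (by positivity)).trans_eq (mul_assoc _ _ _).symm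

variable {θ : ℝ}

/-- The derivation `δ_τ (∑ a_{m,n} U₁^m U₂^n) = 2πi ∑ (mτ + n) a_{m,n} U₁^m U₂^n` of `A_θ`. -/
def delta (θ : ℝ) (τ : ℂ) : SmoothNCTorus θ →ₗ[ℂ] SmoothNCTorus θ where
  toFun a := ⟨fun v => iota τ v * a v, by
    intro k
    obtain ⟨C, hC1, hC⟩ := exists_norm_iota_le τ
    obtain ⟨D, hD⟩ := a.decay (k + 1)
    refine ⟨C * D, fun v => ?_⟩
    have hs := size_pos v
    calc size v ^ k * ‖iota τ v * a v‖ = size v ^ k * (‖iota τ v‖ * ‖a v‖) := by rw [norm_mul]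
      _ ≤ size v ^ k * ((C * size v) * ‖a v‖) := by gcongr; exact hC v
      _ = C * (size v ^ (k + 1) * ‖a v‖) := by ring
      _ ≤ C * D := by gcongr; exact hD v⟩
  map_add' a b := by
    ext v
    exact mul_add (iota τ v) (a v) (b v)
  map_smul' c a := by
    ext v
    exact mul_left_comm (iota τ v) c (a v)

/-- The operator `ad(a) x = a x - x a` on `A_θ`. -/
def ad (a : SmoothNCTorus θ) : SmoothNCTorus θ →ₗ[ℂ] SmoothNCTorus θ :=
  LinearMap.mulLeft ℂ a - LinearMap.mulRight ℂ a

/-- The operator `d_a = δ_τ + ad(a)` on `A_θ`. -/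
def dOp (τ : ℂ) (a : SmoothNCTorus θ) : SmoothNCTorus θ →ₗ[ℂ] SmoothNCTorus θ :=
  delta θ τ + ad a

/-- The hyperplane `H` of all `a ∈ A_θ` with `tr(a) = a_{0,0} = 0`. -/
def traceZero (θ : ℝ) : Submodule ℂ (SmoothNCTorus θ) where
  carrier := {a | a 0 = 0}
  zero_mem' := rfl
  add_mem' := by
    intro a b (ha : a 0 = 0) (hb : b 0 = 0)
    change a 0 + b 0 = 0
    rw [ha, hb, add_zero]
  smul_mem' := by
    intro c a (ha : a 0 = 0)
    change c * a 0 = 0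
    rw [ha, mul_zero]

/-- The discriminant locus `Θ_τ`: all `a ∈ H` with `dim ker(d_a : A_θ → A_θ) > 1`. -/
def discriminant (θ : ℝ) (τ : ℂ) : Set (traceZero θ) :=
  {a | 1 < Module.rank ℂ (LinearMap.ker (dOp τ (a : SmoothNCTorus θ)))}

/-! ### Sobolev spaces -/

/-- The weight `(1 + |2πi(mτ + n)|²)^{1/2}`. -/
def sobolevWeight (τ : ℂ) (v : ℤ × ℤ) : ℝ := Real.sqrt (1 + ‖iota τ v‖ ^ 2)

lemma one_le_sobolevWeight (τ : ℂ) (v : ℤ × ℤ) : 1 ≤ sobolevWeight τ v := by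
  rw [sobolevWeight, Real.one_le_sqrt]
  nlinarith [sq_nonneg ‖iota τ v‖]

lemma sobolevWeight_pos (τ : ℂ) (v : ℤ × ℤ) : 0 < sobolevWeight τ v :=
  lt_of_lt_of_le one_pos (one_le_sobolevWeight τ v)

/-- The index set `ℤ² \ {0}`. -/
abbrev PuncturedLattice : Type := {v : ℤ × ℤ // v ≠ 0}

/-- The coefficient families of the elements of `W_s(H)`: those `(x_v)`, `v ∈ ℤ² \ {0}`, for which
`((1 + |2πi(mτ + n)|²)^{s/2} x_{m,n})` is square summable. -/
def sobolevSubmodule (τ : ℂ) (s : ℤ) : Submodule ℂ (PuncturedLattice → ℂ) where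
  carrier := {x | Memℓp (fun v : PuncturedLattice => (sobolevWeight τ v.1 ^ s : ℝ) • x v) 2}
  zero_mem' := by
    change Memℓp (fun v : PuncturedLattice => (sobolevWeight τ v.1 ^ s : ℝ) • (0 : ℂ)) 2
    simp only [smul_zero]
    exact zero_memℓp
  add_mem' := by
    intro x y hx hy
    have h := Memℓp.add hx hy
    have h' : (fun v : PuncturedLattice => (sobolevWeight τ v.1 ^ s : ℝ) • (x + y) v) =
        (fun v : PuncturedLattice => (sobolevWeight τ v.1 ^ s : ℝ) • x v) +
          fun v : PuncturedLattice => (sobolevWeight τ v.1 ^ s : ℝ) • y v := by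
      funext v
      simp only [Pi.add_apply, smul_add]
    change Memℓp (fun v : PuncturedLattice => (sobolevWeight τ v.1 ^ s : ℝ) • (x + y) v) 2
    rw [h']
    exact h
  smul_mem' := by
    intro c x hx
    have h := Memℓp.const_smul hx c
    have h' : (fun v : PuncturedLattice => (sobolevWeight τ v.1 ^ s : ℝ) • (c • x) v) =
        c • fun v : PuncturedLattice => (sobolevWeight τ v.1 ^ s : ℝ) • x v := by
      funext v
      simp only [Pi.smul_apply]
      rw [smul_comm]
    change Memℓp (fun v : PuncturedLattice => (sobolevWeight τ v.1 ^ s : ℝ) • (c • x) v) 2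
    rw [h']
    exact h

end NCTorus

open NCTorus in
/-- The trace zero part `W_s(H)` of the Sobolev space `W_s`: formal series `∑ x_{m,n} U₁^m U₂^n`
without constant term, with `‖x‖_s² = ∑ (1 + |2πi(mτ + n)|²)^s |x_{m,n}|² < ∞`. -/
def SobolevH (τ : ℂ) (s : ℤ) : Type := sobolevSubmodule τ s

namespace SobolevH

open NCTorus

variable {τ : ℂ} {s : ℤ}

instance : AddCommGroup (SobolevH τ s) := inferInstanceAs (AddCommGroup (sobolevSubmodule τ s))
instance : Module ℂ (SobolevH τ s) := inferInstanceAs (Module ℂ (sobolevSubmodule τ s))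
instance : FunLike (SobolevH τ s) PuncturedLattice ℂ where
  coe x := x.1
  coe_injective := Subtype.val_injective

/-- The weighting `(x_v) ↦ ((1 + |2πi(mτ + n)|²)^{s/2} x_v)`. -/
def toL2 (τ : ℂ) (s : ℤ) :
    SobolevH τ s ≃ₗ[ℂ] lp (fun _ : PuncturedLattice => ℂ) 2 where
  toFun x := ⟨fun v => (sobolevWeight τ v.1 ^ s : ℝ) • x v, x.2⟩
  map_add' x y := by
    ext v
    exact smul_add (sobolevWeight τ v.1 ^ s : ℝ) (x v) (y v)
  map_smul' c x := by
    ext v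
    exact smul_comm (sobolevWeight τ v.1 ^ s : ℝ) c (x v)
  invFun y := ⟨fun v => ((sobolevWeight τ v.1 ^ s)⁻¹ : ℝ) • y v, by
    change Memℓp (fun v : PuncturedLattice =>
      (sobolevWeight τ v.1 ^ s : ℝ) • ((sobolevWeight τ v.1 ^ s)⁻¹ : ℝ) • y v) 2
    have h : (fun v : PuncturedLattice =>
        (sobolevWeight τ v.1 ^ s : ℝ) • ((sobolevWeight τ v.1 ^ s)⁻¹ : ℝ) • y v) = y := by
      funext v
      exact smul_inv_smul₀ (zpow_pos (sobolevWeight_pos τ v) s).ne' (y v)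
    rw [h]
    exact y.2⟩
  left_inv x := by
    apply DFunLike.ext
    intro v
    exact inv_smul_smul₀ (zpow_pos (sobolevWeight_pos τ v) s).ne' (x v)
  right_inv y := by
    ext v
    exact smul_inv_smul₀ (zpow_pos (sobolevWeight_pos τ v) s).ne' (y v)

instance : NormedAddCommGroup (SobolevH τ s) :=
  NormedAddCommGroup.induced (SobolevH τ s) (lp (fun _ : PuncturedLattice => ℂ) 2)
    (toL2 τ s) (toL2 τ s).injective

instance : InnerProductSpace ℂ (SobolevH τ s) where
  __ := NormedSpace.induced ℂ (SobolevH τ s) (lp (fun _ : PuncturedLattice => ℂ) 2) (toL2 τ s)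
  inner x y := inner ℂ (toL2 τ s x) (toL2 τ s y)
  norm_sq_eq_re_inner x := norm_sq_eq_re_inner (𝕜 := ℂ) (toL2 τ s x)
  conj_inner_symm x y := inner_conj_symm (toL2 τ s x) (toL2 τ s y)
  add_left x y z := by
    rw [map_add]
    exact inner_add_left _ _ _
  smul_left x y c := by
    rw [map_smul]
    exact inner_smul_left _ _ _

instance : CompleteSpace (SobolevH τ s) := by
  have h : IsUniformInducing (toL2 τ s) := ⟨rfl⟩
  rw [h.completeSpace_congr (toL2 τ s).surjective]
  infer_instance

/-- The map `A_θ → W_s(H)` that forgets the constant term of a series. On the trace zero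
subspace `H` it is the inclusion `H ⊂ W_s(H)`. -/
def ofSmooth {θ : ℝ} (τ : ℂ) (s : ℤ) (a : SmoothNCTorus θ) : SobolevH τ s :=
  ⟨fun v => a v.1, by
    change Memℓp (fun v : PuncturedLattice => (sobolevWeight τ v.1 ^ s : ℝ) • a v.1) 2
    obtain ⟨C, hC1, hC⟩ := exists_norm_iota_le τ
    have hw : ∀ v, sobolevWeight τ v ≤ 2 * C * size v := by
      intro v
      have h1 := one_le_size v
      have h2 := hC v
      have h3 : 1 ≤ C * size v := one_le_mul_of_one_le_of_one_le hC1 h1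
      rw [sobolevWeight, Real.sqrt_le_left (by linarith)]
      nlinarith [norm_nonneg (iota τ v)]
    have hbound : ∀ v, sobolevWeight τ v ^ s ≤ (2 * C) ^ s.natAbs * size v ^ s.natAbs := by
      intro v
      have h1 := one_le_sobolevWeight τ v
      calc sobolevWeight τ v ^ s ≤ sobolevWeight τ v ^ (s.natAbs : ℤ) :=
            zpow_le_zpow_right₀ h1 (by omega)
        _ = sobolevWeight τ v ^ s.natAbs := zpow_natCast _ _
        _ ≤ (2 * C * size v) ^ s.natAbs :=
            pow_le_pow_left₀ (sobolevWeight_pos τ v).le (hw v) _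
        _ = (2 * C) ^ s.natAbs * size v ^ s.natAbs := mul_pow _ _ _
    have h1 : Memℓp (fun v : PuncturedLattice => (sobolevWeight τ v.1 ^ s : ℝ) • a v.1) 1 := by
      refine memℓp_gen ?_
      have hsum : Summable (fun v : ℤ × ℤ => (2 * C) ^ s.natAbs * (size v ^ s.natAbs * ‖a v‖)) :=
        (a.summable_weighted s.natAbs).mul_left _
      have hsub := hsum.subtype {v : ℤ × ℤ | v ≠ 0}
      refine Summable.of_nonneg_of_le (fun v => by positivity) (fun v => ?_) hsub
      have hz : 0 < sobolevWeight τ v ^ s := zpow_pos (sobolevWeight_pos τ v) s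
      simp only [ENNReal.toReal_one, Real.rpow_one, norm_smul, Real.norm_of_nonneg hz.le,
        Function.comp_apply]
      rw [← mul_assoc]
      exact mul_le_mul_of_nonneg_right (hbound v) (norm_nonneg _)
    exact h1.of_exponent_ge (by norm_num)⟩

end SobolevH

namespace NCTorus

variable {θ : ℝ}

/-- The bounded operator `T : W_0(H) → W_{-1}(H)` is the (unique) continuous extension of the
operator `f` of `A_θ`, restricted to `H`. -/
def IsSobolevExtension {τ : ℂ} (f : SmoothNCTorus θ →ₗ[ℂ] SmoothNCTorus θ)
    (T : SobolevH τ 0 →L[ℂ] SobolevH τ (-1)) : Prop :=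
  ∀ x ∈ traceZero θ, f x ∈ traceZero θ ∧
    T (SobolevH.ofSmooth τ 0 x) = SobolevH.ofSmooth τ (-1) (f x)

end NCTorus

/-! ### The determinant line bundle -/

namespace QuillenDet

section

variable {E : Type*} [NormedAddCommGroup E] [InnerProductSpace ℂ E] [CompleteSpace E]
variable {F : Type*} [NormedAddCommGroup F] [InnerProductSpace ℂ F] [CompleteSpace F]

/-- Trace class operators between Hilbert spaces, characterized as the nuclear operators:
`A x = ∑ φ_n(x) u_n` with `∑ ‖φ_n‖ ‖u_n‖ < ∞`. -/
def IsTraceClass (A : E →L[ℂ] F) : Prop :=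
  ∃ (φ : ℕ → E →L[ℂ] ℂ) (u : ℕ → F),
    Summable (fun n => ‖φ n‖ * ‖u n‖) ∧ ∀ x, HasSum (fun n => φ n x • u n) (A x)

variable (E F) in
/-- The set of trace class operators from `E` to `F`. -/
abbrev TraceClass : Type _ := {A : E →L[ℂ] F // IsTraceClass A}

variable (E) in
/-- An orthonormal basis of the Hilbert space `E`. -/
def onb : HilbertBasis (exists_hilbertBasis ℂ E).choose ℂ E :=
  (exists_hilbertBasis ℂ E).choose_spec.choose

open scoped Classical in
/-- The Fredholm determinant `det_F(1 + K)` of a trace class operator `K`: the limit of the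
determinants of the finite sections `(δ_{ij} + ⟨e_i, K e_j⟩)_{i,j ∈ S}` of `1 + K` in an
orthonormal basis `(e_i)`, as the finite set `S` of indices grows. (For `K` of trace class the
limit exists and does not depend on the basis.) -/
def detOneAdd (K : E →L[ℂ] E) : ℂ :=
  limUnder atTop fun S : Finset (exists_hilbertBasis ℂ E).choose =>
    Matrix.det (1 + Matrix.of fun i j : S => inner ℂ (onb E i) (K (onb E j)))

/-- Fredholm operators of index zero. -/
def IsFredholmZero (T : E →L[ℂ] F) : Prop :=
  T.IsFredholm ∧ Module.finrank ℂ T.ker = Module.finrank ℂ (F ⧸ T.range)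

variable (E F) in
/-- The space of Fredholm operators of index zero from `E` to `F`, with the norm topology. -/
abbrev FredholmZero : Type _ := {T : E →L[ℂ] F // IsFredholmZero T}

/-- The transition function `g_{A,B}(T) = det_F(1 + (A - B)(T + B)⁻¹)`. -/
def transition (A B : TraceClass E F) (T : E →L[ℂ] F) : ℂ :=
  detOneAdd ((A.1 - B.1) ∘L (T + B.1).inverse)

/-- The function `s_A(T) = det_F(1 - (T + A)⁻¹ A)`. -/
def localSection (A : TraceClass E F) (T : E →L[ℂ] F) : ℂ :=
  detOneAdd (-((T + A.1).inverse ∘L A.1))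

/-- `L` is Quillen's determinant line bundle on the Fredholm operators of index zero: it is glued
from trivial line bundles over the sets `U_A` of all `T` with `T + A` invertible, `A` of trace
class, by the transition functions `g_{A,B}`. -/
structure IsDeterminantLineBundle
    (L : VectorBundleCore ℂ (FredholmZero E F) ℂ (TraceClass E F)) : Prop where
  baseSet_eq : ∀ A, L.baseSet A = {T | (T.1 + A.1).IsInvertible}
  coordChange_eq : ∀ A B, ∀ T ∈ L.baseSet A ∩ L.baseSet B, ∀ z : ℂ,
    L.coordChange A B T z = transition A B T.1 * z

/-- The canonical section of the determinant line bundle: over `U_A` it is given by `s_A`. -/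
def IsCanonicalSection (L : VectorBundleCore ℂ (FredholmZero E F) ℂ (TraceClass E F))
    (σ : ∀ T, L.Fiber T) : Prop :=
  ∀ A, ∀ T ∈ L.baseSet A, (L.localTriv A ⟨T, σ T⟩).2 = localSection A T.1

end

section

variable {B : Type*} [TopologicalSpace B] {ι : Type*}
variable {V : Type*} [AddCommGroup V] [Module ℂ V] [TopologicalSpace V]

/-- The pull-back of the line bundle `L` under `p : V → B` is a holomorphic line bundle on the
topological vector space `V`: the pulled back transition functions are holomorphic on the (open)
overlaps of the pulled back charts. -/
def IsHolomorphicPullback (L : VectorBundleCore ℂ B ℂ ι) (p : V → B) : Prop :=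
  Continuous p ∧ ∀ i j, DifferentiableOn ℂ (fun a => L.coordChange i j (p a) 1)
    (p ⁻¹' (L.baseSet i ∩ L.baseSet j))

/-- The section `s` of the pull-back of the line bundle `L` under `p : V → B` is holomorphic:
so is its expression in each of the pulled back charts. -/
def IsHolomorphicSection (L : VectorBundleCore ℂ B ℂ ι) (p : V → B)
    (s : ∀ a, (Bundle.Pullback p L.Fiber) a) : Prop :=
  ∀ i, DifferentiableOn ℂ (fun a => (L.localTriv i ⟨p a, s a⟩).2) (p ⁻¹' L.baseSet i)

end

end QuillenDet

end

/-! On coefficients `δ_τ` multiplies by `2πi(mτ + n)`. Since `Im τ ≠ 0`, these numbers are nonzero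
off the origin and grow like `|m| + |n|`. Hence `δ_τ` extends to an isomorphism `W_0(H) →
W_{-1}(H)`, and its inverse, viewed on `ℓ²`, is diagonal with entries tending to zero, so it is a
norm limit of finite rank operators. The operator `ad(a)` is an absolutely convergent sum of
weighted shifts, hence bounded on `ℓ²`. Therefore `d_a = δ_τ (1 + K)` with `K = δ_τ⁻¹ ad(a)`
compact, and `d_a` is Fredholm of index zero (`isFredholmZero_add_adSobolev`).

Membership in `Θ_τ` means that `d_a` is not invertible on `W_0(H)` (`mem_discriminant_iff`). The
kernel in `A_θ` always contains `1`, so it has dimension greater than one exactly when it meets `H`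
nontrivially. Elliptic regularity (`zeroExtend_mem_rapidlyDecreasing`) shows that kernel vectors in
`W_0(H)` are smooth, and index zero turns injectivity into invertibility.

For (i), `1 - (T + A)⁻¹ A = (T + A)⁻¹ T`, so `s_A(T)` vanishes exactly when `T` is not invertible,
provided `det_F(1 + K) ≠ 0` characterizes invertibility of `1 + K`. The theory of `det_F` rests on
one expansion: for `K = ∑ φ_i ⊗ u_i` the determinant is the sum of the principal minors of
`(φ_i(u_j))`, and Hadamard's inequality bounds a minor by the product of the `‖φ_i‖ ‖u_i‖`.
Dominated convergence then gives independence of the basis, `det_F(1 + AX) = det_F(1 + XA)`,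
multiplicativity and holomorphy (`IsNuclearRep.detOneAdd_eq`, `IsNuclearRep.detOneAdd_mul`,
`differentiable_minorSeries`).

For (ii), `ta ∈ Θ_τ` means that `1 + tK` is not invertible. By the analytic Fredholm argument
(`eventually_isUnit_one_add_smul`) such `t` are isolated, because `1 + tK` is invertible at `t = 0`.
-/

set_option linter.unusedSectionVars false

/-! ### Hadamard's inequality and principal minors -/

namespace QuillenDet

/-- Hadamard's inequality for the determinant with respect to an orthonormal basis. -/
lemma norm_orthonormalBasis_det_le {n : ℕ} {V : Type*} [NormedAddCommGroup V]
    [InnerProductSpace ℂ V] [FiniteDimensional ℂ V] (b : OrthonormalBasis (Fin n) ℂ V)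
    (f : Fin n → V) : ‖b.toBasis.det f‖ ≤ ∏ i, ‖f i‖ := by
  have h : Module.finrank ℂ V = Fintype.card (Fin n) := Module.finrank_eq_card_basis b.toBasis
  -- Passing between orthonormal bases costs a factor of modulus one, and in the Gram–Schmidt basis
  -- the coordinates of `f` are triangular.
  set g := InnerProductSpace.gramSchmidtOrthonormalBasis h f
  have h1 : b.toBasis.det f = b.toBasis.det g * g.toBasis.det f := by
    have := AlternatingMap.eq_smul_basis_det g.toBasis b.toBasis.det
    conv_lhs => rw [this]
    simp
  rw [h1, norm_mul, OrthonormalBasis.det_to_matrix_orthonormalBasis, one_mul,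
    InnerProductSpace.gramSchmidtOrthonormalBasis_det, norm_prod]
  refine Finset.prod_le_prod (fun _ _ => norm_nonneg _) fun i _ => ?_
  refine (norm_inner_le_norm _ _).trans_eq ?_
  rw [OrthonormalBasis.norm_eq_one, one_mul]

section

variable {E : Type*} [NormedAddCommGroup E] [InnerProductSpace ℂ E]

/-- Projecting the `u j` to the span of `f` does not change the inner products. There the Gram
matrix is a product of two coordinate matrices in an orthonormal basis, and Hadamard's inequality
applies to each. If `f` is linearly dependent, the determinant vanishes. -/
lemma norm_det_inner_le {n : ℕ} (f u : Fin n → E) :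
    ‖Matrix.det (Matrix.of fun i j => inner ℂ (f i) (u j))‖ ≤ (∏ i, ‖f i‖) * ∏ i, ‖u i‖ := by
  by_cases hf : LinearIndependent ℂ f
  · set V := Submodule.span ℂ (Set.range f)
    have hfin : FiniteDimensional ℂ V := FiniteDimensional.span_of_finite ℂ (Set.finite_range f)
    have hdim : Module.finrank ℂ V = n := by
      rw [finrank_span_eq_card hf, Fintype.card_fin]
    let b : OrthonormalBasis (Fin n) ℂ V := (stdOrthonormalBasis ℂ V).reindex (finCongr hdim)
    let f' : Fin n → V := fun i => ⟨f i, Submodule.subset_span ⟨i, rfl⟩⟩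
    let u' : Fin n → V := fun i => V.orthogonalProjectionOnto (u i)
    have hM : (Matrix.of fun i j => inner ℂ (f i) (u j)) =
        (b.toBasis.toMatrix f').conjTranspose * b.toBasis.toMatrix u' := by
      ext i j
      have h1 : inner ℂ (f i) (u j) = inner ℂ (f' i) (u' j) := by
        rw [Submodule.coe_inner]
        exact (Submodule.inner_orthogonalProjectionOnto_eq_of_mem_left (f' i) (u j)).symm
      rw [Matrix.of_apply, h1, ← b.sum_inner_mul_inner, Matrix.mul_apply]
      refine Finset.sum_congr rfl fun k _ => ?_
      simp [Module.Basis.toMatrix_apply, OrthonormalBasis.repr_apply_apply]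
    rw [hM, Matrix.det_mul, Matrix.det_conjTranspose, norm_mul, norm_star]
    refine mul_le_mul (norm_orthonormalBasis_det_le b f')
      ((norm_orthonormalBasis_det_le b u').trans ?_) (norm_nonneg _)
      (Finset.prod_nonneg fun _ _ => norm_nonneg _)
    exact Finset.prod_le_prod (fun _ _ => norm_nonneg _) fun i _ =>
      Submodule.norm_orthogonalProjectionOnto_apply_le V (u i)
  · rw [Fintype.not_linearIndependent_iff] at hf
    obtain ⟨c, hc, i, hi⟩ := hf
    have h0 : Matrix.det (Matrix.of fun i j => inner ℂ (f i) (u j)) = 0 := by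
      rw [← Matrix.exists_vecMul_eq_zero_iff]
      refine ⟨fun i => (starRingEnd ℂ) (c i), fun h => hi ?_, ?_⟩
      · simpa using congrFun h i
      · ext j
        have := congrArg (fun x => inner ℂ x (u j)) hc
        simpa [sum_inner, inner_smul_left, Matrix.vecMul, dotProduct, mul_comm] using this
    rw [h0, norm_zero]
    positivity

variable [CompleteSpace E]

/-- The Riesz isometry turns functionals into vectors and reduces this to inner products. -/
lemma norm_det_apply_le {ι : Type*} [Fintype ι] [DecidableEq ι] (φ : ι → E →L[ℂ] ℂ) (u : ι → E) :
    ‖Matrix.det (Matrix.of fun i j => φ i (u j))‖ ≤ ∏ i, ‖φ i‖ * ‖u i‖ := by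
  let e := Fintype.equivFin ι
  have h := norm_det_inner_le (fun i => (InnerProductSpace.toDual ℂ E).symm (φ (e.symm i)))
    (fun i => u (e.symm i))
  have h1 : (Matrix.of fun i j => inner ℂ ((InnerProductSpace.toDual ℂ E).symm (φ (e.symm i)))
      (u (e.symm j))) = (Matrix.of fun i j => φ i (u j)).submatrix e.symm e.symm := by
    ext i j
    simp
  rw [h1, Matrix.det_submatrix_equiv_self] at h
  refine h.trans_eq ?_
  simp only [LinearIsometryEquiv.norm_map]
  rw [← Finset.prod_mul_distrib]
  exact e.symm.prod_comp fun i => ‖φ i‖ * ‖u i‖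

/-- Multilinearity in the rows: each row comes from `M` or from the identity, and the identity rows
cut the determinant down to a principal minor. -/
lemma det_one_add_eq_sum_minors {n : Type*} [Fintype n] [DecidableEq n] (M : Matrix n n ℂ) :
    Matrix.det (1 + M) = ∑ s : Finset n, (M.submatrix (↑) (↑) : Matrix s s ℂ).det := by
  have h : Matrix.det (1 + M) = (Matrix.detRowAlternating (n := n) (R := ℂ))
      ((fun i => M i) + fun i => (1 : Matrix n n ℂ) i) := by
    rw [add_comm]; rfl
  rw [h, AlternatingMap.map_add_univ]
  exact Finset.sum_congr rfl fun s _ => Matrix.det_piecewise_one_eq_submatrix_det M s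

/-- The principal minor of the matrix `(φ i (u j))` with index set `s`. -/
noncomputable def pairingMinor {ι : Type*} (φ : ι → E →L[ℂ] ℂ) (u : ι → E) (s : Finset ι) : ℂ :=
  open scoped Classical in Matrix.det (Matrix.of fun i j : s => φ i (u j))

/-- The Fredholm determinant of `1 + ∑ φ i ⊗ u i`, as the sum of the principal minors of the
matrix `(φ i (u j))`. -/
noncomputable def minorSeries {ι : Type*} (φ : ι → E →L[ℂ] ℂ) (u : ι → E) : ℂ :=
  ∑' s : Finset ι, pairingMinor φ u s

lemma pairingMinor_eq {ι : Type*} [DecidableEq ι] (φ : ι → E →L[ℂ] ℂ) (u : ι → E)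
    (s : Finset ι) :
    pairingMinor φ u s = Matrix.det (Matrix.of fun i j : s => φ i (u j)) := by
  unfold pairingMinor
  congr!

/-- This is the majorant for every limit taken in the minor series: its sum over all finite `s`
converges as soon as `∑ ‖φ i‖ * ‖u i‖` does. -/
lemma norm_pairingMinor_le {ι : Type*} (φ : ι → E →L[ℂ] ℂ) (u : ι → E) (s : Finset ι) :
    ‖pairingMinor φ u s‖ ≤ ∏ i ∈ s, ‖φ i‖ * ‖u i‖ := by
  classical
  refine (norm_det_apply_le (fun i : s => φ i) (fun i : s => u i)).trans_eq ?_
  exact Finset.prod_coe_sort s fun i => ‖φ i‖ * ‖u i‖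

lemma summable_prod_norm {ι : Type*} {a : ι → ℝ} (ha : ∀ i, 0 ≤ a i) (h : Summable a) :
    Summable fun s : Finset ι => ∏ i ∈ s, a i :=
  summable_finsetProd_of_summable_nonneg ha h

lemma sum_powerset_pairingMinor {ι : Type*} (φ : ι → E →L[ℂ] ℂ) (u : ι → E) [DecidableEq ι]
    (s : Finset ι) :
    ∑ t ∈ s.powerset, pairingMinor φ u t =
      Matrix.det (1 + Matrix.of fun i j : s => φ i (u j)) := by
  classical
  rw [det_one_add_eq_sum_minors]
  symm
  refine Finset.sum_bij' (fun t _ => t.map (Function.Embedding.subtype _))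
    (fun t _ => t.subtype (· ∈ s)) ?_ ?_ ?_ ?_ ?_
  · intro t _
    rw [Finset.mem_powerset]
    exact Finset.map_subtype_subset t
  · intro t _; exact Finset.mem_univ _
  · intro t _
    ext ⟨x, hx⟩
    simp [hx]
  · intro t ht
    rw [Finset.mem_powerset] at ht
    ext x
    simp only [Finset.mem_map, Finset.mem_subtype, Function.Embedding.subtype_apply,
      Subtype.exists, exists_and_left, exists_prop, exists_eq_right_right]
    exact ⟨fun h => h.1, fun h => ⟨h, ht h⟩⟩
  · intro t _
    let e : t ≃ (t.map (Function.Embedding.subtype (· ∈ s))) :=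
      { toFun := fun x => ⟨x.1.1, Finset.mem_map_of_mem _ x.2⟩
        invFun := fun x => ⟨⟨x.1, Finset.property_of_mem_map_subtype t x.2⟩, by
          obtain ⟨_, h⟩ := by simpa using Finset.mem_map.mp x.2
          exact h⟩
        left_inv := fun _ => rfl
        right_inv := fun _ => rfl }
    have h := Matrix.det_submatrix_equiv_self e (Matrix.of fun i j => φ i.1 (u j.1))
    rw [pairingMinor_eq, ← h]
    rfl

end
end QuillenDet

/-! ### Nuclear representations and the Fredholm determinant as a minor series -/

namespace QuillenDet

section

variable {E : Type*} [NormedAddCommGroup E] [InnerProductSpace ℂ E] [CompleteSpace E]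
variable {F : Type*} [NormedAddCommGroup F] [InnerProductSpace ℂ F] [CompleteSpace F]
variable {G : Type*} [NormedAddCommGroup G] [InnerProductSpace ℂ G] [CompleteSpace G]
variable {ι κ : Type*}

/-- The operator `A` has the nuclear representation `A x = ∑ φ i x • u i`. -/
structure IsNuclearRep (φ : ι → E →L[ℂ] ℂ) (u : ι → F) (A : E →L[ℂ] F) : Prop where
  summable : Summable fun i => ‖φ i‖ * ‖u i‖
  hasSum : ∀ x, HasSum (fun i => φ i x • u i) (A x)

lemma IsNuclearRep.comp_left {φ : ι → E →L[ℂ] ℂ} {u : ι → F} {A : E →L[ℂ] F}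
    (h : IsNuclearRep φ u A) (X : F →L[ℂ] G) : IsNuclearRep φ (fun i => X (u i)) (X ∘L A) where
  summable := by
    refine Summable.of_nonneg_of_le (fun i => by positivity) (fun i => ?_)
      (h.summable.mul_left ‖X‖)
    calc ‖φ i‖ * ‖X (u i)‖ ≤ ‖φ i‖ * (‖X‖ * ‖u i‖) := by gcongr; exact X.le_opNorm _
      _ = ‖X‖ * (‖φ i‖ * ‖u i‖) := by ring
  hasSum x := by simpa using (h.hasSum x).mapL X

lemma IsNuclearRep.comp_right {φ : ι → E →L[ℂ] ℂ} {u : ι → F} {A : E →L[ℂ] F}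
    (h : IsNuclearRep φ u A) (X : G →L[ℂ] E) :
    IsNuclearRep (fun i => φ i ∘L X) u (A ∘L X) where
  summable := by
    refine Summable.of_nonneg_of_le (fun i => by positivity) (fun i => ?_)
      (h.summable.mul_left ‖X‖)
    calc ‖φ i ∘L X‖ * ‖u i‖ ≤ (‖φ i‖ * ‖X‖) * ‖u i‖ := by
          gcongr; exact ContinuousLinearMap.opNorm_comp_le _ _
      _ = ‖X‖ * (‖φ i‖ * ‖u i‖) := by ring
  hasSum x := h.hasSum (X x)

lemma IsNuclearRep.add {φ : ι → E →L[ℂ] ℂ} {u : ι → F} {A : E →L[ℂ] F}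
    {ψ : κ → E →L[ℂ] ℂ} {w : κ → F} {B : E →L[ℂ] F}
    (hA : IsNuclearRep φ u A) (hB : IsNuclearRep ψ w B) :
    IsNuclearRep (Sum.elim φ ψ) (Sum.elim u w) (A + B) where
  summable := by
    have h1 : HasSum (fun i : ι ⊕ κ => ‖Sum.elim φ ψ i‖ * ‖Sum.elim u w i‖) _ :=
      HasSum.sum hA.summable.hasSum hB.summable.hasSum
    exact h1.summable
  hasSum x := HasSum.sum (f := fun i : ι ⊕ κ => Sum.elim φ ψ i x • Sum.elim u w i)
    (hA.hasSum x) (hB.hasSum x)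

lemma IsNuclearRep.neg {φ : ι → E →L[ℂ] ℂ} {u : ι → F} {A : E →L[ℂ] F}
    (h : IsNuclearRep φ u A) : IsNuclearRep (fun i => -φ i) u (-A) where
  summable := by simpa using h.summable
  hasSum x := by simpa using (h.hasSum x).neg

lemma IsNuclearRep.sum_finset (φ : ι → E →L[ℂ] ℂ) (u : ι → F) (s : Finset ι) :
    IsNuclearRep (fun i : s => φ i) (fun i : s => u i) (∑ i ∈ s, (φ i).smulRight (u i)) where
  summable := Summable.of_finite
  hasSum x := by
    have h := hasSum_fintype fun i : s => φ i x • u i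
    rw [Finset.sum_coe_sort s fun i => φ i x • u i] at h
    simpa using h

lemma IsNuclearRep.isTraceClass [Countable ι] {φ : ι → E →L[ℂ] ℂ} {u : ι → F} {A : E →L[ℂ] F}
    (h : IsNuclearRep φ u A) : IsTraceClass A := by
  obtain ⟨f, hf⟩ := exists_injective_nat ι
  refine ⟨Function.extend f φ 0, Function.extend f u 0, ?_, fun x => ?_⟩
  · refine (hf.summable_iff fun n hn => ?_).mp ?_
    · rw [Function.extend_apply' _ _ _ (by simpa using hn)]
      simp
    · simpa [Function.comp_def, hf.extend_apply] using h.summable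
  · refine (hf.hasSum_iff fun n hn => ?_).mp ?_
    · rw [Function.extend_apply' _ _ _ (by simpa using hn)]
      simp
    · simpa [Function.comp_def, hf.extend_apply] using h.hasSum x

lemma IsTraceClass.exists_rep {A : E →L[ℂ] F} (h : IsTraceClass A) :
    ∃ (φ : ℕ → E →L[ℂ] ℂ) (u : ℕ → F), IsNuclearRep φ u A := by
  obtain ⟨φ, u, h1, h2⟩ := h
  exact ⟨φ, u, h1, h2⟩

lemma summable_pairingMinor {φ : ι → E →L[ℂ] ℂ} {u : ι → E}
    (h : Summable fun i => ‖φ i‖ * ‖u i‖) : Summable (pairingMinor φ u) :=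
  Summable.of_norm_bounded (summable_prod_norm (fun _ => by positivity) h)
    (norm_pairingMinor_le φ u)

/-- Each minor is a polynomial in finitely many entries, so entrywise convergence suffices term by
term. The products of the `c i` dominate the series. -/
lemma tendsto_minorSeries {α : Type*} {l : Filter α} {φ : α → ι → E →L[ℂ] ℂ} {u : α → ι → E}
    {φ₀ : ι → E →L[ℂ] ℂ} {u₀ : ι → E} {c : ι → ℝ} (hc0 : ∀ i, 0 ≤ c i) (hc : Summable c)
    (hlim : ∀ i j, Tendsto (fun a => φ a i (u a j)) l (𝓝 (φ₀ i (u₀ j))))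
    (hbound : ∀ a i, ‖φ a i‖ * ‖u a i‖ ≤ c i) :
    Tendsto (fun a => minorSeries (φ a) (u a)) l (𝓝 (minorSeries φ₀ u₀)) := by
  classical
  refine tendsto_tsum_of_dominated_convergence (summable_prod_norm hc0 hc) (fun s => ?_)
    (Eventually.of_forall fun a s => ?_)
  · simp only [pairingMinor_eq]
    refine Tendsto.comp (continuous_id.matrix_det.tendsto _) ?_
    exact tendsto_pi_nhds.mpr fun i => tendsto_pi_nhds.mpr fun j => hlim i j
  · exact (norm_pairingMinor_le _ _ s).trans
      (Finset.prod_le_prod (fun _ _ => by positivity) fun i _ => hbound a i)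

/-- The determinant over `s` is the partial sum of the minor series over the subsets of `s`, and
powersets are cofinal among finite families of finite sets. -/
lemma tendsto_det_pairing [DecidableEq ι] {φ : ι → E →L[ℂ] ℂ} {u : ι → E}
    (h : Summable fun i => ‖φ i‖ * ‖u i‖) :
    Tendsto (fun s : Finset ι => Matrix.det (1 + Matrix.of fun i j : s => φ i (u j))) atTop
      (𝓝 (minorSeries φ u)) := by
  have := (summable_pairingMinor h).hasSum.comp tendsto_finset_powerset_atTop_atTop
  exact this.congr fun s => sum_powerset_pairingMinor φ u s

lemma norm_partial_sum_le (b : HilbertBasis κ ℂ E) (s : Finset κ) (x : E) :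
    ‖∑ k ∈ s, inner ℂ (b k) x • b k‖ ≤ ‖x‖ := by
  have h1 : ‖∑ k ∈ s, inner ℂ (b k) x • b k‖ ^ 2 = ∑ k ∈ s, ‖inner ℂ (b k) x‖ ^ 2 := by
    rw [@norm_sq_eq_re_inner ℂ, b.orthonormal.inner_sum, map_sum]
    refine Finset.sum_congr rfl fun k _ => ?_
    rw [RCLike.conj_mul]
    norm_cast
  have h2 := b.orthonormal.sum_inner_products_le (s := s) x
  rw [← h1] at h2
  exact le_of_sq_le_sq h2 (norm_nonneg x)

/-- The identity `det(1 + XY) = det(1 + YX)` trades the section in the basis `b` for the pairing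
matrix of the `φ i` with projected vectors. It is applied to finite partial sums of the
representation, followed by a limit. -/
lemma det_finite_section [DecidableEq κ] (b : HilbertBasis κ ℂ E) {φ : ι → E →L[ℂ] ℂ} {u : ι → E}
    {K : E →L[ℂ] E} (h : IsNuclearRep φ u K) (s : Finset κ) :
    Matrix.det (1 + Matrix.of fun i j : s => inner ℂ (b i) (K (b j))) =
      minorSeries φ fun i => ∑ k ∈ s, inner ℂ (b k) (u i) • b k := by
  classical
  have hs : Summable fun i => ‖φ i‖ * ‖∑ k ∈ s, inner ℂ (b k) (u i) • b k‖ :=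
    Summable.of_nonneg_of_le (fun i => by positivity)
      (fun i => by gcongr; exact norm_partial_sum_le b s (u i)) h.summable
  refine tendsto_nhds_unique ?_ (tendsto_det_pairing hs)
  have hdet : ∀ t : Finset ι,
      Matrix.det (1 + Matrix.of fun i j : t => φ i (∑ k ∈ s, inner ℂ (b k) (u j) • b k)) =
      Matrix.det (1 + Matrix.of fun i j : s => inner ℂ (b i) (∑ n ∈ t, φ n (b j) • u n)) := by
    intro t
    have h1 : (Matrix.of fun i j : t => φ i (∑ k ∈ s, inner ℂ (b k) (u j) • b k)) =
        (Matrix.of fun (i : t) (k : s) => φ i (b k)) *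
          (Matrix.of fun (k : s) (j : t) => inner ℂ (b k) (u j)) := by
      ext i j
      simp only [Matrix.of_apply, Matrix.mul_apply, map_sum, map_smul, smul_eq_mul]
      rw [← Finset.sum_coe_sort s]
      exact Finset.sum_congr rfl fun k _ => mul_comm _ _
    have h2 : (Matrix.of fun i j : s => inner ℂ (b i) (∑ n ∈ t, φ n (b j) • u n)) =
        (Matrix.of fun (k : s) (j : t) => inner ℂ (b k) (u j)) *
          (Matrix.of fun (i : t) (k : s) => φ i (b k)) := by
      ext i j
      simp only [Matrix.of_apply, Matrix.mul_apply, inner_sum, inner_smul_right]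
      rw [← Finset.sum_coe_sort t]
      exact Finset.sum_congr rfl fun k _ => mul_comm _ _
    rw [h1, h2, Matrix.det_one_add_mul_comm]
  simp only [hdet]
  refine Tendsto.comp (continuous_id.matrix_det.tendsto _) ?_
  refine Tendsto.const_add _ ?_
  refine tendsto_pi_nhds.mpr fun i => tendsto_pi_nhds.mpr fun j => ?_
  exact ((innerSL ℂ (b i)).continuous.tendsto _).comp (h.hasSum (b j))

/-- The projections of `u i` converge to `u i` without exceeding its norm, so dominated convergence
applies. The limit does not involve `b`, which gives the independence of the basis. -/
lemma tendsto_det_finite_section [DecidableEq κ] (b : HilbertBasis κ ℂ E) {φ : ι → E →L[ℂ] ℂ}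
    {u : ι → E} {K : E →L[ℂ] E} (h : IsNuclearRep φ u K) :
    Tendsto (fun s : Finset κ =>
      Matrix.det (1 + Matrix.of fun i j : s => inner ℂ (b i) (K (b j)))) atTop
      (𝓝 (minorSeries φ u)) := by
  simp only [det_finite_section b h]
  refine tendsto_minorSeries (fun i => by positivity) h.summable (fun i j => ?_) fun s i => ?_
  · refine ((φ i).continuous.tendsto _).comp ?_
    have := b.hasSum_repr (u j)
    simp only [b.repr_apply_apply] at this
    exact this
  · gcongr
    exact norm_partial_sum_le b s (u i)

/-- The Fredholm determinant is the sum of principal minors of any nuclear representation. -/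
lemma IsNuclearRep.detOneAdd_eq {φ : ι → E →L[ℂ] ℂ} {u : ι → E} {K : E →L[ℂ] E}
    (h : IsNuclearRep φ u K) : detOneAdd K = minorSeries φ u := by
  classical
  have := (tendsto_det_finite_section (onb E) h).limUnder_eq
  rw [← this, detOneAdd]

/-- Both compositions have representations with the same pairing matrix `(φ i (X (u j)))`, hence the
same minors. -/
lemma IsNuclearRep.detOneAdd_comp_comm {φ : ι → E →L[ℂ] ℂ} {u : ι → F} {A : E →L[ℂ] F}
    (h : IsNuclearRep φ u A) (X : F →L[ℂ] E) : detOneAdd (A ∘L X) = detOneAdd (X ∘L A) := by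
  rw [(h.comp_left X).detOneAdd_eq, (h.comp_right X).detOneAdd_eq]
  rfl

lemma IsNuclearRep.detOneAdd_eq_det [Fintype ι] [DecidableEq ι] {φ : ι → E →L[ℂ] ℂ} {u : ι → E}
    {K : E →L[ℂ] E} (h : IsNuclearRep φ u K) :
    detOneAdd K = Matrix.det (1 + Matrix.of fun i j => φ i (u j)) := by
  rw [h.detOneAdd_eq, minorSeries, tsum_fintype, det_one_add_eq_sum_minors]
  refine Finset.sum_congr rfl fun s _ => ?_
  rw [pairingMinor_eq]
  rfl

end
end QuillenDet

namespace QuillenDet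

section

variable {E : Type*} [NormedAddCommGroup E] [InnerProductSpace ℂ E] [CompleteSpace E]
variable {F : Type*} [NormedAddCommGroup F] [InnerProductSpace ℂ F] [CompleteSpace F]
variable {ι κ : Type*}

/-! ### Multiplicativity -/

/-- The operator is `(1 + K)(1 + M) - 1 = K(1 + M) + M`. This grouping produces a pairing matrix
that factors into block triangular pieces. -/
lemma IsNuclearRep.one_add_mul {φ : ι → E →L[ℂ] ℂ} {u : ι → E} {K : E →L[ℂ] E}
    {ψ : κ → E →L[ℂ] ℂ} {w : κ → E} {M : E →L[ℂ] E}
    (hK : IsNuclearRep φ u K) (hM : IsNuclearRep ψ w M) :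
    IsNuclearRep (Sum.elim (fun i => φ i ∘L (1 + M)) ψ) (Sum.elim u w) (K + M + K ∘L M) := by
  have h := (hK.comp_right (1 + M)).add hM
  have h2 : K ∘L (1 + M) + M = K + M + K ∘L M := by
    ext x
    simp only [add_apply, ContinuousLinearMap.comp_apply,
      one_apply_eq_self, map_add]
    abel
  rwa [h2] at h

lemma detOneAdd_mul_of_fintype [Fintype ι] [Fintype κ] {φ : ι → E →L[ℂ] ℂ} {u : ι → E}
    {K : E →L[ℂ] E} {ψ : κ → E →L[ℂ] ℂ} {w : κ → E} {M : E →L[ℂ] E}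
    (hK : IsNuclearRep φ u K) (hM : IsNuclearRep ψ w M) :
    detOneAdd (K + M + K ∘L M) = detOneAdd K * detOneAdd M := by
  classical
  rw [hK.detOneAdd_eq_det, hM.detOneAdd_eq_det, (hK.one_add_mul hM).detOneAdd_eq_det]
  let a : Matrix ι ι ℂ := Matrix.of fun i j => φ i (u j)
  let b : Matrix ι κ ℂ := Matrix.of fun i j => φ i (w j)
  let c : Matrix κ ι ℂ := Matrix.of fun i j => ψ i (u j)
  let d : Matrix κ κ ℂ := Matrix.of fun i j => ψ i (w j)
  have hMx : ∀ x, M x = ∑ n, ψ n x • w n := fun x =>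
    (hM.hasSum x).unique (hasSum_fintype _)
  have h1 : (1 + Matrix.of fun i j =>
      (Sum.elim (fun i => φ i ∘L (1 + M)) ψ : ι ⊕ κ → E →L[ℂ] ℂ) i (Sum.elim u w j)) =
      Matrix.fromBlocks (1 + a + b * c) (b + b * d) c (1 + d) := by
    ext (i | i) (j | j)
    · simp [a, b, c, Matrix.mul_apply, hMx, Matrix.one_apply, mul_comm, add_assoc]
    · simp [b, d, Matrix.mul_apply, hMx, mul_comm]
    · simp [c]
    · simp [d, Matrix.one_apply]
  -- Row reduction by a unipotent block matrix leaves the diagonal blocks `1 + a` and `1 + d`.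
  have h2 : Matrix.fromBlocks (1 + a + b * c) (b + b * d) c (1 + d) =
      Matrix.fromBlocks 1 b 0 1 * Matrix.fromBlocks (1 + a) 0 c (1 + d) := by
    rw [Matrix.fromBlocks_multiply]
    congr 1 <;> simp [Matrix.mul_add]
  rw [h1, h2, Matrix.det_mul, Matrix.det_fromBlocks_zero₂₁, Matrix.det_fromBlocks_zero₁₂]
  simp [a, d]

open scoped Classical in
-- Truncating by zero keeps the index type fixed, so that all truncations can be compared within one
-- minor series.
lemma IsNuclearRep.truncate (φ : ι → E →L[ℂ] ℂ) (u : ι → F) (s : Finset ι) :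
    IsNuclearRep φ (fun i => if i ∈ s then u i else 0) (∑ i ∈ s, (φ i).smulRight (u i)) where
  summable := (hasSum_sum_of_ne_finset_zero (s := s) (L := SummationFilter.unconditional ι)
    fun i hi => by simp [hi]).summable
  hasSum x := by
    have h : HasSum (fun i => φ i x • if i ∈ s then u i else 0)
        (∑ i ∈ s, φ i x • if i ∈ s then u i else 0) :=
      hasSum_sum_of_ne_finset_zero fun i hi => by simp [hi]
    convert h using 1
    rw [sum_apply]
    exact Finset.sum_congr rfl fun i hi => by simp [hi]

lemma norm_sum_smulRight_le {φ : ι → E →L[ℂ] ℂ} {u : ι → F}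
    (h : Summable fun i => ‖φ i‖ * ‖u i‖) (s : Finset ι) :
    ‖∑ i ∈ s, (φ i).smulRight (u i)‖ ≤ ∑' i, ‖φ i‖ * ‖u i‖ := by
  refine (norm_sum_le _ _).trans ?_
  simp only [ContinuousLinearMap.norm_smulRight_apply]
  exact h.sum_le_tsum s fun _ _ => by positivity

open scoped Classical in
lemma tendsto_truncate (u : ι → F) (j : ι) :
    Tendsto (fun s : Finset ι => if j ∈ s then u j else 0) atTop (𝓝 (u j)) := by
  refine tendsto_const_nhds.congr' ?_
  filter_upwards [eventually_ge_atTop {j}] with s hs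
  rw [if_pos (hs (Finset.mem_singleton_self j))]

open scoped Classical in
lemma norm_truncate_le (u : ι → F) (s : Finset ι) (j : ι) :
    ‖if j ∈ s then u j else 0‖ ≤ ‖u j‖ := by
  split_ifs <;> simp

lemma IsNuclearRep.tendsto_detOneAdd {φ : ι → E →L[ℂ] ℂ} {u : ι → E} {K : E →L[ℂ] E}
    (h : IsNuclearRep φ u K) :
    Tendsto (fun s : Finset ι => detOneAdd (∑ i ∈ s, (φ i).smulRight (u i))) atTop
      (𝓝 (detOneAdd K)) := by
  classical
  simp only [(IsNuclearRep.truncate φ u _).detOneAdd_eq, h.detOneAdd_eq]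
  refine tendsto_minorSeries (fun i => by positivity) h.summable (fun i j => ?_) fun s i => ?_
  · exact ((φ i).continuous.tendsto _).comp (tendsto_truncate u j)
  · gcongr
    exact norm_truncate_le u s i

/-- Both factors are truncated to finite rank, where block matrices give the identity, and both
truncations are removed in one dominated limit. -/
lemma IsNuclearRep.detOneAdd_mul {φ : ι → E →L[ℂ] ℂ} {u : ι → E} {K : E →L[ℂ] E}
    {ψ : κ → E →L[ℂ] ℂ} {w : κ → E} {M : E →L[ℂ] E}
    (hK : IsNuclearRep φ u K) (hM : IsNuclearRep ψ w M) :
    detOneAdd (K + M + K ∘L M) = detOneAdd K * detOneAdd M := by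
  classical
  let Ks : Finset ι → E →L[ℂ] E := fun s => ∑ i ∈ s, (φ i).smulRight (u i)
  let Mt : Finset κ → E →L[ℂ] E := fun t => ∑ i ∈ t, (ψ i).smulRight (w i)
  let l : Filter (Finset ι × Finset κ) := atTop ×ˢ atTop
  have h1 : Tendsto (fun p : Finset ι × Finset κ => detOneAdd (Ks p.1) * detOneAdd (Mt p.2)) l
      (𝓝 (detOneAdd K * detOneAdd M)) :=
    (hK.tendsto_detOneAdd.comp tendsto_fst).mul (hM.tendsto_detOneAdd.comp tendsto_snd)
  refine tendsto_nhds_unique ?_ h1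
  have h2 : ∀ p : Finset ι × Finset κ, detOneAdd (Ks p.1) * detOneAdd (Mt p.2) =
      minorSeries (Sum.elim (fun i => φ i ∘L (1 + Mt p.2)) ψ)
        (Sum.elim (fun i => if i ∈ p.1 then u i else 0) fun i => if i ∈ p.2 then w i else 0) := by
    intro p
    rw [← detOneAdd_mul_of_fintype (IsNuclearRep.sum_finset φ u p.1)
      (IsNuclearRep.sum_finset ψ w p.2)]
    exact ((IsNuclearRep.truncate φ u p.1).one_add_mul
      (IsNuclearRep.truncate ψ w p.2)).detOneAdd_eq
  simp only [h2, (hK.one_add_mul hM).detOneAdd_eq]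
  -- `C` bounds the norm of every truncation of `M`, so `1 + C` bounds `1 + Mt p.2` uniformly.
  let C : ℝ := ∑' i, ‖ψ i‖ * ‖w i‖
  have hC : 0 ≤ C := tsum_nonneg fun i => by positivity
  have hu : ∀ j, Tendsto (fun p : Finset ι × Finset κ =>
      (Sum.elim (fun i => if i ∈ p.1 then u i else 0)
        (fun i => if i ∈ p.2 then w i else 0) : ι ⊕ κ → E) j) l (𝓝 (Sum.elim u w j)) := by
    rintro (j | j)
    · exact (tendsto_truncate u j).comp tendsto_fst
    · exact (tendsto_truncate w j).comp tendsto_snd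
  have hMt : ∀ j, Tendsto (fun p : Finset ι × Finset κ => Mt p.2
      ((Sum.elim (fun i => if i ∈ p.1 then u i else 0)
        (fun i => if i ∈ p.2 then w i else 0) : ι ⊕ κ → E) j)) l (𝓝 (M (Sum.elim u w j))) := by
    intro j
    have h3 : Tendsto (fun p : Finset ι × Finset κ => Mt p.2 (Sum.elim u w j)) l
        (𝓝 (M (Sum.elim u w j))) := by
      have := hM.hasSum (Sum.elim u w j)
      refine (Tendsto.comp this tendsto_snd).congr fun p => ?_
      simp [Mt]
    refine h3.congr' ?_
    obtain j | j := j
    · have : ∀ᶠ p : Finset ι × Finset κ in l, j ∈ p.1 := by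
        refine (tendsto_fst (f := atTop) (g := atTop)).eventually (p := fun s => j ∈ s) ?_
        filter_upwards [eventually_ge_atTop {j}] with s hs using hs (Finset.mem_singleton_self j)
      filter_upwards [this] with p hp
      simp [hp]
    · have : ∀ᶠ p : Finset ι × Finset κ in l, j ∈ p.2 := by
        refine (tendsto_snd (f := atTop) (g := atTop)).eventually (p := fun s => j ∈ s) ?_
        filter_upwards [eventually_ge_atTop {j}] with s hs using hs (Finset.mem_singleton_self j)
      filter_upwards [this] with p hp
      simp [hp]
  have hsum : Summable (Sum.elim (fun i => (1 + C) * (‖φ i‖ * ‖u i‖)) fun i => ‖ψ i‖ * ‖w i‖) :=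
    (HasSum.sum (f := Sum.elim (fun i => (1 + C) * (‖φ i‖ * ‖u i‖)) fun i => ‖ψ i‖ * ‖w i‖)
      (hK.summable.mul_left (1 + C)).hasSum hM.summable.hasSum).summable
  refine tendsto_minorSeries ?_ hsum ?_ ?_
  · rintro (i | i) <;> simp <;> positivity
  · rintro (i | i) j
    · simp only [Sum.elim_inl, ContinuousLinearMap.comp_apply, add_apply,
        one_apply_eq_self]
      exact ((φ i).continuous.tendsto _).comp ((hu j).add (hMt j))
    · exact ((ψ i).continuous.tendsto _).comp (hu j)
  · rintro p (i | i)
    · simp only [Sum.elim_inl]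
      have h4 : ‖φ i ∘L (1 + Mt p.2)‖ ≤ ‖φ i‖ * (1 + C) := by
        refine (ContinuousLinearMap.opNorm_comp_le _ _).trans ?_
        gcongr
        refine (norm_add_le _ _).trans ?_
        gcongr
        · exact ContinuousLinearMap.norm_id_le
        · exact norm_sum_smulRight_le hM.summable p.2
      calc _ ≤ (‖φ i‖ * (1 + C)) * ‖u i‖ := by
            gcongr
            exact norm_truncate_le u p.1 i
        _ = _ := by ring
    · simp only [Sum.elim_inr]
      gcongr
      exact norm_truncate_le w p.2 i

/-! ### Invertibility -/

lemma detOneAdd_zero : detOneAdd (0 : E →L[ℂ] E) = 1 := by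
  have h : IsNuclearRep (fun i : Empty => i.elim) (fun i : Empty => i.elim) (0 : E →L[ℂ] E) :=
    ⟨Summable.of_finite, fun x => by simp⟩
  rw [h.detOneAdd_eq_det]
  simp

/-- With `K = UΦ` factored through `ℂ^ι` and `N = ΦU`, the inverse of `1 + UΦ` is `1 - U(1 + N)⁻¹Φ`.
-/
lemma isUnit_of_one_add_matrix [Fintype ι] [DecidableEq ι] {φ : ι → E →L[ℂ] ℂ} {u : ι → E}
    {K : E →L[ℂ] E} (h : IsNuclearRep φ u K)
    (hdet : Matrix.det (1 + Matrix.of fun i j => φ i (u j)) ≠ 0) : IsUnit (1 + K) := by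
  set N : Matrix ι ι ℂ := Matrix.of fun i j => φ i (u j)
  have hKx : ∀ x, K x = ∑ n, φ n x • u n := fun x => (h.hasSum x).unique (hasSum_fintype _)
  let R := (1 + N)⁻¹
  have hR1 : (1 + N) * R = 1 := Matrix.mul_nonsing_inv _ (isUnit_iff_ne_zero.mpr hdet)
  have hR2 : R * (1 + N) = 1 := Matrix.nonsing_inv_mul _ (isUnit_iff_ne_zero.mpr hdet)
  let U : (ι → ℂ) →ₗ[ℂ] E := Fintype.linearCombination ℂ u
  let Φ : E →ₗ[ℂ] (ι → ℂ) := LinearMap.pi fun i => (φ i : E →ₗ[ℂ] ℂ)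
  let L : E →L[ℂ] E := ∑ i, (φ i).smulRight (∑ j, R j i • u j)
  have hL : ∀ x, L x = U (R.mulVec (Φ x)) := by
    intro x
    simp only [L, U, Φ, sum_apply, ContinuousLinearMap.smulRight_apply,
      Fintype.linearCombination_apply, Matrix.mulVec, dotProduct, Finset.sum_smul,
      Finset.smul_sum, smul_smul, LinearMap.pi_apply, ContinuousLinearMap.coe_coe]
    rw [Finset.sum_comm]
    exact Finset.sum_congr rfl fun i _ => Finset.sum_congr rfl fun j _ => by rw [mul_comm]
  have hK : ∀ x, K x = U (Φ x) := by
    intro x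
    simp [hKx, U, Φ, Fintype.linearCombination_apply]
  have hΦU : ∀ v, Φ (U v) = N.mulVec v := by
    intro v
    ext i
    simp [Φ, U, N, Fintype.linearCombination_apply, Matrix.mulVec, dotProduct, mul_comm]
  refine ⟨⟨1 + K, 1 - L, ?_, ?_⟩, rfl⟩
  · ext x
    have h1 : U (Φ x) = U (R.mulVec (Φ x)) + U (N.mulVec (R.mulVec (Φ x))) := by
      rw [← map_add, Matrix.mulVec_mulVec, ← Matrix.add_mulVec]
      congr 1
      have : R + N * R = (1 + N) * R := by rw [add_mul, one_mul]
      rw [this, hR1, Matrix.one_mulVec]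
    change (x - L x) + K (x - L x) = x
    rw [hL, hK, map_sub, map_sub, hΦU, h1]
    abel
  · ext x
    have h1 : U (Φ x) = U (R.mulVec (Φ x)) + U (R.mulVec (N.mulVec (Φ x))) := by
      rw [← map_add, Matrix.mulVec_mulVec, ← Matrix.add_mulVec]
      congr 1
      have : R + R * N = R * (1 + N) := by rw [mul_add, mul_one]
      rw [this, hR2, Matrix.one_mulVec]
    change (x + K x) - L (x + K x) = x
    rw [hL, hK, map_add, hΦU, Matrix.mulVec_add, map_add, h1]
    abel

lemma IsNuclearRep.tendsto_sum_smulRight {φ : ι → E →L[ℂ] ℂ} {u : ι → F} {K : E →L[ℂ] F}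
    (h : IsNuclearRep φ u K) :
    Tendsto (fun s : Finset ι => ∑ i ∈ s, (φ i).smulRight (u i)) atTop (𝓝 K) := by
  have hs : Summable fun i => (φ i).smulRight (u i) := by
    refine Summable.of_norm ?_
    simpa only [ContinuousLinearMap.norm_smulRight_apply] using h.summable
  have hK : ∑' i, (φ i).smulRight (u i) = K := by
    ext x
    have h1 := hs.hasSum.mapL (ContinuousLinearMap.apply ℂ F x)
    exact h1.unique (h.hasSum x)
  rw [← hK]
  exact hs.hasSum

/-- Write `K = S + F` with `‖S‖ < 1` and `F` of finite rank. Then `1 + K = (1 + S)(1 + (1 + S)⁻¹F)`,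
and multiplicativity reduces invertibility to a finite matrix. Conversely, the inverse of `1 + K` is
again of the form `1 +` nuclear, so the two determinants multiply to one. -/
lemma IsNuclearRep.detOneAdd_ne_zero_iff {φ : ι → E →L[ℂ] ℂ} {u : ι → E} {K : E →L[ℂ] E}
    (h : IsNuclearRep φ u K) : detOneAdd K ≠ 0 ↔ IsUnit (1 + K) := by
  classical
  constructor
  · intro hne
    have hev : ∀ᶠ s : Finset ι in atTop, ‖K - ∑ i ∈ s, (φ i).smulRight (u i)‖ < 1 := by
      have := ((tendsto_const_nhds (x := K)).sub h.tendsto_sum_smulRight).norm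
      rw [sub_self, norm_zero] at this
      exact this.eventually (gt_mem_nhds one_pos)
    obtain ⟨s, hs⟩ := hev.exists
    set Fs : E →L[ℂ] E := ∑ i ∈ s, (φ i).smulRight (u i) with hFs
    set S : E →L[ℂ] E := K - Fs with hS
    have hSu : IsUnit (1 + S) := by
      have := isUnit_one_sub_of_norm_lt_one (x := -S) (by rwa [norm_neg])
      rwa [sub_neg_eq_add] at this
    obtain ⟨V, hV⟩ := hSu
    have hF := (IsNuclearRep.sum_finset φ u s).comp_left (↑V⁻¹ : E →L[ℂ] E)
    rw [← hFs] at hF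
    -- Multiplicativity needs a representation of `S`: that of `K` with the negated finite part
    -- appended.
    have hSrep : IsNuclearRep (Sum.elim φ fun i : s => -φ i) (Sum.elim u fun i : s => u i) S := by
      rw [hS, sub_eq_add_neg]
      exact h.add (IsNuclearRep.sum_finset φ u s).neg
    have hprod : (1 + S) * (1 + (↑V⁻¹ : E →L[ℂ] E) * Fs) = 1 + K := by
      rw [mul_add, mul_one, ← hV, ← mul_assoc, V.mul_inv, one_mul, hV, hS]
      abel
    have hK2 : K = S + (↑V⁻¹ : E →L[ℂ] E) ∘L Fs + S ∘L ((↑V⁻¹ : E →L[ℂ] E) ∘L Fs) := by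
      have h3 : (1 + S) * (1 + (↑V⁻¹ : E →L[ℂ] E) * Fs) =
          1 + (S + (↑V⁻¹ : E →L[ℂ] E) * Fs + S * ((↑V⁻¹ : E →L[ℂ] E) * Fs)) := by noncomm_ring
      rw [hprod] at h3
      exact add_left_cancel h3
    rw [hK2, hSrep.detOneAdd_mul hF] at hne
    have h4 := right_ne_zero_of_mul hne
    rw [hF.detOneAdd_eq_det] at h4
    rw [← hprod]
    exact IsUnit.mul ⟨V, hV⟩ (isUnit_of_one_add_matrix hF h4)
  · rintro ⟨V, hV⟩ h0
    -- With `V = 1 + K`, the inverse is `V⁻¹ = 1 - V⁻¹K`.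
    have hM := (h.comp_left (↑V⁻¹ : E →L[ℂ] E)).neg
    have h1 := h.detOneAdd_mul hM
    have h2 : K + -((↑V⁻¹ : E →L[ℂ] E) ∘L K) + K ∘L (-((↑V⁻¹ : E →L[ℂ] E) ∘L K)) = 0 := by
      have h3 : K + -((↑V⁻¹ : E →L[ℂ] E) * K) + K * (-((↑V⁻¹ : E →L[ℂ] E) * K)) =
          K - (1 + K) * (↑V⁻¹ : E →L[ℂ] E) * K := by noncomm_ring
      rw [← hV, V.mul_inv, one_mul, sub_self] at h3
      exact h3
    rw [h2, h0, zero_mul, detOneAdd_zero] at h1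
    exact one_ne_zero h1

/-! ### Holomorphy -/

lemma differentiable_pairingMinor (φ : ι → E →L[ℂ] ℂ) (u : ι → F) (s : Finset ι) :
    Differentiable ℂ fun X : F →L[ℂ] E => pairingMinor φ (fun i => X (u i)) s := by
  classical
  simp only [pairingMinor_eq, Matrix.det_apply', Matrix.of_apply]
  fun_prop

/-- Differentiation term by term: the minors are polynomial in `X`, and Cauchy estimates convert a
summable bound on a larger ball into a summable bound on the derivatives. -/
lemma differentiable_minorSeries {φ : ι → E →L[ℂ] ℂ} {u : ι → F}
    (h : Summable fun i => ‖φ i‖ * ‖u i‖) :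
    Differentiable ℂ fun X : F →L[ℂ] E => minorSeries φ fun i => X (u i) := by
  intro X₀
  set R : ℝ := ‖X₀‖ + 1
  have hR : 0 ≤ R := by positivity
  let c : Finset ι → ℝ := fun s => ∏ i ∈ s, (R + 1) * (‖φ i‖ * ‖u i‖)
  have hc : Summable c := summable_prod_norm (fun i => by positivity) (h.mul_left (R + 1))
  have hbd : ∀ s, ∀ X ∈ Metric.ball (0 : F →L[ℂ] E) (R + 1),
      ‖pairingMinor φ (fun i => X (u i)) s‖ ≤ c s := by
    intro s X hX
    rw [mem_ball_zero_iff] at hX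
    refine (norm_pairingMinor_le _ _ s).trans
      (Finset.prod_le_prod (fun _ _ => by positivity) fun i _ => ?_)
    calc ‖φ i‖ * ‖X (u i)‖ ≤ ‖φ i‖ * (‖X‖ * ‖u i‖) := by gcongr; exact X.le_opNorm _
      _ ≤ ‖φ i‖ * ((R + 1) * ‖u i‖) := by gcongr
      _ = _ := by ring
  have hfd : ∀ s, ∀ X ∈ Metric.ball (0 : F →L[ℂ] E) R,
      ‖fderiv ℂ (fun X : F →L[ℂ] E => pairingMinor φ (fun i => X (u i)) s) X‖ ≤ 2 * c s := by
    intro s X hX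
    -- The unit ball about `X` stays in the larger ball, where `c s` bounds the minor. Its
    -- oscillation there is at most `2 * c s`, which is the constant in the Cauchy estimate.
    have hsub : Metric.ball X 1 ⊆ Metric.ball (0 : F →L[ℂ] E) (R + 1) := by
      refine Metric.ball_subset_ball' ?_
      rw [Metric.mem_ball] at hX
      linarith
    have := Complex.norm_fderiv_le_div_of_mapsTo_ball (R₂ := 2 * c s)
      (differentiable_pairingMinor φ u s).differentiableOn (c := X) (R₁ := 1) ?_ one_pos
    · simpa using this
    · intro Y hY
      rw [mem_closedBall_iff_norm]
      have h1 := hbd s Y (hsub hY)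
      have h2 := hbd s X (hsub (Metric.mem_ball_self one_pos))
      exact (norm_sub_le _ _).trans (by linarith)
  have hX₀ : X₀ ∈ Metric.ball (0 : F →L[ℂ] E) R := by
    rw [mem_ball_zero_iff]
    simp [R]
  refine (hasFDerivAt_tsum_of_isPreconnected (hc.mul_left 2) Metric.isOpen_ball
    (convex_ball _ _).isPreconnected
    (fun s X _ => (differentiable_pairingMinor φ u s X).hasFDerivAt) hfd hX₀ ?_
    hX₀).differentiableAt
  exact Summable.of_norm_bounded hc fun s =>
    hbd s X₀ (Metric.ball_subset_ball (by linarith) hX₀)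

end
end QuillenDet

namespace QuillenDet

section

variable {E : Type*} [NormedAddCommGroup E] [InnerProductSpace ℂ E] [CompleteSpace E]
variable {F : Type*} [NormedAddCommGroup F] [InnerProductSpace ℂ F] [CompleteSpace F]

/-! ### Fredholm operators of index zero -/

lemma isTraceClass_comp_of_finiteDimensional {V : Type*} [NormedAddCommGroup V] [NormedSpace ℂ V]
    [FiniteDimensional ℂ V] (j : V →L[ℂ] F) (p : E →L[ℂ] V) : IsTraceClass (j ∘L p) := by
  let b := Module.finBasis ℂ V
  have h : IsNuclearRep (fun i => (b.coord i).toContinuousLinearMap ∘L p) (fun i => j (b i))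
      (j ∘L p) := by
    refine ⟨Summable.of_finite, fun x => ?_⟩
    have h1 := hasSum_fintype fun i => b.repr (p x) i • j (b i)
    simp only [← map_smul, ← map_sum, b.sum_repr] at h1
    simpa using h1
  exact h.isTraceClass

lemma isInvertible_of_bijective {T : E →L[ℂ] F} (h : Function.Bijective T) : T.IsInvertible :=
  ⟨ContinuousLinearEquiv.ofBijective T (LinearMap.ker_eq_bot.mpr h.1)
    (LinearMap.range_eq_top.mpr h.2), by ext; rfl⟩

lemma isUnit_iff_isInvertible {T : E →L[ℂ] E} : IsUnit T ↔ T.IsInvertible := by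
  constructor
  · rintro ⟨U, rfl⟩
    exact ContinuousLinearMap.IsInvertible.of_inverse U.mul_inv U.inv_mul
  · rintro ⟨e, rfl⟩
    exact ⟨⟨e, e.symm, by ext; simp, by ext; simp⟩, rfl⟩

/-- Index zero provides an isomorphism from the kernel to a complement of the range. Composed with a
projection to the kernel, it is a finite rank correction that removes both defects. Hence the sets
`U_A` cover. -/
lemma IsFredholmZero.exists_add_isInvertible {T : E →L[ℂ] F} (h : IsFredholmZero T) :
    ∃ A : TraceClass E F, (T + A.1).IsInvertible := by
  obtain ⟨hT, hind⟩ := h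
  have := hT.finite_ker
  have hcof := hT.finite_coker
  obtain ⟨p, hp⟩ := hT.closedComplemented_ker
  obtain ⟨C, hC⟩ := hT.closedComplemented_range.exists_isTopCompl
  have hCc : IsCompl T.range C := hC.isCompl
  have hCfin : FiniteDimensional ℂ C := .of_fg (hcof.fg_of_isCompl hCc)
  have hdim : Module.finrank ℂ T.ker = Module.finrank ℂ C :=
    hind.trans (Submodule.quotientEquivOfIsCompl _ _ hCc).finrank_eq
  let e : T.ker ≃L[ℂ] C := (LinearEquiv.ofFinrankEq _ _ hdim).toContinuousLinearEquiv
  refine ⟨⟨(C.subtypeL ∘L e.toContinuousLinearMap) ∘L p,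
    isTraceClass_comp_of_finiteDimensional _ p⟩, isInvertible_of_bijective ⟨?_, ?_⟩⟩
  · rw [injective_iff_map_eq_zero]
    intro x hx
    have hx' : T x + (e (p x) : F) = 0 := hx
    have h1 : (e (p x) : F) = T (-x) := by
      rw [map_neg]; exact (neg_eq_of_add_eq_zero_right hx').symm
    have h2 : (e (p x) : F) = 0 :=
      Submodule.disjoint_def.mp hCc.disjoint _ (h1 ▸ LinearMap.mem_range_self _ _) (e (p x)).2
    have h3 : T x = 0 := by rw [h2, add_zero] at hx'; exact hx'
    have h4 : p x = 0 := e.map_eq_zero_iff.mp (Subtype.ext h2)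
    have h5 := hp ⟨x, h3⟩
    rw [h4] at h5
    exact (congrArg Subtype.val h5).symm
  · intro y
    obtain ⟨_, ⟨x, rfl⟩, c, hc, rfl⟩ := Submodule.mem_sup.mp
      (hCc.sup_eq_top ▸ Submodule.mem_top : y ∈ T.range ⊔ C)
    let z : T.ker := e.symm ⟨c, hc⟩
    -- Removing the kernel component of `x` leaves `T x` unchanged, and `z` in the kernel then
    -- contributes exactly `c`.
    refine ⟨x - p x + z, ?_⟩
    have h1 : T (p x : E) = 0 := (p x).2
    have h2 : T (z : E) = 0 := z.2
    change T (x - p x + z) + (e (p (x - p x + z)) : F) = T x + c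
    rw [map_add, map_sub, h1, h2, map_add, map_sub, hp, hp, sub_self, zero_add, add_zero, sub_zero]
    simp [z]

/-- Since `x = (1 + G)x - Gx`, kernel and cokernel of `1 + G` are those of its restriction to the
finite-dimensional range of `G`, where rank-nullity applies. -/
lemma finrank_ker_one_add_eq {V : Type*} [AddCommGroup V] [Module ℂ V] (G : V →ₗ[ℂ] V)
    (hG : G.HasFiniteRange) :
    Module.finrank ℂ (LinearMap.ker (1 + G)) = Module.finrank ℂ (V ⧸ LinearMap.range (1 + G)) := by
  have hfin : FiniteDimensional ℂ (LinearMap.range G) := .of_fg hG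
  have hmap : ∀ x ∈ LinearMap.range G, (1 + G) x ∈ LinearMap.range G := fun x hx =>
    add_mem hx (LinearMap.mem_range_self G x)
  let f : LinearMap.range G →ₗ[ℂ] LinearMap.range G := (1 + G).restrict hmap
  have hmem : ∀ {x}, (1 + G) x ∈ LinearMap.range G → x ∈ LinearMap.range G := by
    intro x hx
    have : x = (1 + G) x - G x := by simp
    rw [this]
    exact sub_mem hx (LinearMap.mem_range_self G x)
  have h1 : Module.finrank ℂ (LinearMap.ker (1 + G)) = Module.finrank ℂ (LinearMap.ker f) := by
    refine (LinearEquiv.finrank_eq (LinearEquiv.symm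
      { toFun := fun x => ⟨x.1.1, congrArg Subtype.val x.2⟩
        invFun := fun x => ⟨⟨x.1, hmem (by rw [LinearMap.mem_ker.mp x.2]; exact zero_mem _)⟩,
          Subtype.ext x.2⟩
        map_add' := fun _ _ => rfl
        map_smul' := fun _ _ => rfl
        left_inv := fun _ => rfl
        right_inv := fun _ => rfl }))
  let g : LinearMap.range G →ₗ[ℂ] V ⧸ LinearMap.range (1 + G) :=
    (LinearMap.range (1 + G)).mkQ ∘ₗ (LinearMap.range G).subtype
  have hg : Function.Surjective g := by
    intro y
    obtain ⟨x, rfl⟩ := Submodule.mkQ_surjective _ y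
    refine ⟨⟨G (-x), LinearMap.mem_range_self G _⟩, ?_⟩
    refine (Submodule.Quotient.eq _).mpr ⟨-x, ?_⟩
    simp
    abel
  have hker : LinearMap.ker g = LinearMap.range f := by
    ext x
    constructor
    · intro hx
      obtain ⟨y, hy⟩ := (Submodule.Quotient.mk_eq_zero _).mp (LinearMap.mem_ker.mp hx)
      exact ⟨⟨y, hmem (hy ▸ x.2)⟩, Subtype.ext hy⟩
    · rintro ⟨y, rfl⟩
      exact (Submodule.Quotient.mk_eq_zero _).mpr ⟨y.1, rfl⟩
  have h2 := (g.quotKerEquivOfSurjective hg).finrank_eq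
  rw [hker] at h2
  have h3 := f.finrank_range_add_finrank_ker
  have h4 := (LinearMap.range f).finrank_quotient_add_finrank
  omega

/-- `V⁻¹` inverts `V + A` modulo finite rank, and `V + A = V(1 + V⁻¹A)` carries the index back to an
endomorphism of `E`. -/
lemma isFredholmZero_equiv_add (V : E ≃L[ℂ] F) {A : E →L[ℂ] F}
    (hA : (A : E →ₗ[ℂ] F).HasFiniteRange) : IsFredholmZero (V.toContinuousLinearMap + A) := by
  let G : E →ₗ[ℂ] E := (V.symm : F →ₗ[ℂ] E) ∘ₗ (A : E →ₗ[ℂ] F)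
  have hG : G.HasFiniteRange := hA.comp_left _
  constructor
  · refine ContinuousLinearMap.IsFredholm.of_isQuasiInverse
      (v := V.symm.toContinuousLinearMap) ⟨?_, ?_⟩
    · refine LinearMap.FiniteRangeSetoid.equiv_iff_hasFiniteRange.mpr ?_
      have e : ((V.symm : F →ₗ[ℂ] E) ∘ₗ ((V.toContinuousLinearMap + A : E →L[ℂ] F) : E →ₗ[ℂ] F) -
          LinearMap.id : E →ₗ[ℂ] E) = G := by
        ext x
        simp [G]
      exact e ▸ hG
    · refine LinearMap.FiniteRangeSetoid.equiv_iff_hasFiniteRange.mpr ?_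
      have e : (((V.toContinuousLinearMap + A : E →L[ℂ] F) : E →ₗ[ℂ] F) ∘ₗ (V.symm : F →ₗ[ℂ] E) -
          LinearMap.id : F →ₗ[ℂ] F) = (A : E →ₗ[ℂ] F) ∘ₗ (V.symm : F →ₗ[ℂ] E) := by
        ext x
        simp
      exact e ▸ hA.comp_right (V.symm : F →ₗ[ℂ] E)
  · have h1 : ∀ x, (V.toContinuousLinearMap + A) x = V ((1 + G) x) := by
      intro x; simp [G]
    have hker : (V.toContinuousLinearMap + A).ker = LinearMap.ker (1 + G) := by
      ext x
      rw [LinearMap.mem_ker, LinearMap.mem_ker]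
      refine Iff.trans (iff_of_eq (congrArg (· = 0) (h1 x))) ?_
      exact V.map_eq_zero_iff
    have hrange : Submodule.map (V.toLinearEquiv : E →ₗ[ℂ] F) (LinearMap.range (1 + G)) =
        (V.toContinuousLinearMap + A).range := by
      rw [← LinearMap.range_comp]
      congr 1
      ext x
      exact (h1 x).symm
    rw [hker, finrank_ker_one_add_eq G hG]
    exact (Submodule.Quotient.equiv _ _ V.toLinearEquiv hrange).finrank_eq

lemma IsFredholmZero.isInvertible_of_injective {T : E →L[ℂ] F} (h : IsFredholmZero T)
    (hinj : Function.Injective T) : T.IsInvertible := by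
  obtain ⟨hT, hind⟩ := h
  have hk : T.ker = ⊥ := LinearMap.ker_eq_bot.mpr hinj
  rw [hk, finrank_bot] at hind
  have : Module.Finite ℂ (F ⧸ T.range) := hT.finite_coker
  have h1 := Module.finrank_zero_iff.mp hind.symm
  have h2 := Submodule.Quotient.subsingleton_iff.mp h1
  exact isInvertible_of_bijective ⟨hinj, LinearMap.range_eq_top.mp h2⟩

/-! ### The determinant line bundle and its canonical section -/

lemma differentiableOn_inverse_add (A : E →L[ℂ] F) :
    DifferentiableOn ℂ (fun T : E →L[ℂ] F => (T + A).inverse) {T | (T + A).IsInvertible} := by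
  intro T hT
  have h1 : DifferentiableAt ℂ ContinuousLinearMap.inverse (T + A) :=
    (ContinuousLinearMap.IsInvertible.contDiffAt_map_inverse (n := 1) hT).differentiableAt
      (by norm_num)
  exact (DifferentiableAt.comp T h1 (differentiableAt_id.add_const A)).differentiableWithinAt

/-- Commuting the two factors moves the dependence on `T` into the vectors `(T + B)⁻¹ u_i`, the form
covered by `differentiable_minorSeries`. -/
lemma exists_transition_eq (A B : TraceClass E F) :
    ∃ (φ : ℕ ⊕ ℕ → E →L[ℂ] ℂ) (u : ℕ ⊕ ℕ → F), IsNuclearRep φ u (A.1 - B.1) ∧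
      ∀ T, transition A B T = minorSeries φ fun i => (T + B.1).inverse (u i) := by
  obtain ⟨φ, u, hA⟩ := A.2.exists_rep
  obtain ⟨ψ, w, hB⟩ := B.2.exists_rep
  have h := hA.add hB.neg
  rw [← sub_eq_add_neg] at h
  exact ⟨_, _, h, fun T => by
    rw [transition, h.detOneAdd_comp_comm, (h.comp_left _).detOneAdd_eq]⟩

lemma differentiableOn_transition (A B : TraceClass E F) :
    DifferentiableOn ℂ (transition A B) {T | (T + A.1).IsInvertible ∧ (T + B.1).IsInvertible} := by
  obtain ⟨φ, u, h, hT⟩ := exists_transition_eq A B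
  rw [funext hT]
  exact (differentiable_minorSeries h.summable).comp_differentiableOn
    ((differentiableOn_inverse_add B.1).mono fun T hT => hT.2)

lemma differentiableOn_localSection (A : TraceClass E F) :
    DifferentiableOn ℂ (localSection A) {T | (T + A.1).IsInvertible} := by
  obtain ⟨φ, u, h⟩ := A.2.exists_rep
  have h1 : ∀ T, localSection A T = minorSeries (fun i => -φ i) fun i => (T + A.1).inverse (u i) :=
    fun T => (h.comp_left _).neg.detOneAdd_eq
  rw [funext h1]
  exact (differentiable_minorSeries h.neg.summable).comp_differentiableOn
    (differentiableOn_inverse_add A.1)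

lemma transition_self (A : TraceClass E F) (T : E →L[ℂ] F) : transition A A T = 1 := by
  rw [transition, sub_self, ContinuousLinearMap.zero_comp, detOneAdd_zero]

/-- Since `1 + (A - B)(T + B)⁻¹ = (T + A)(T + B)⁻¹`, the cocycle rule is multiplicativity of the
determinant after cancelling `T + B`. -/
lemma transition_mul_transition (A B C : TraceClass E F) {T : E →L[ℂ] F}
    (hB : (T + B.1).IsInvertible) (hC : (T + C.1).IsInvertible) :
    transition B C T * transition A B T = transition A C T := by
  obtain ⟨φ, u, h1, -⟩ := exists_transition_eq A B
  obtain ⟨ψ, w, h2, -⟩ := exists_transition_eq B C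
  obtain ⟨b, hb⟩ := hB
  obtain ⟨c, hc⟩ := hC
  rw [mul_comm, transition, transition, transition, ← hb, ← hc,
    ContinuousLinearMap.inverse_equiv, ContinuousLinearMap.inverse_equiv]
  rw [← (h1.comp_right (b.symm : F →L[ℂ] E)).detOneAdd_mul (h2.comp_right (c.symm : F →L[ℂ] E))]
  congr 1
  ext y
  obtain ⟨z, rfl⟩ := c.surjective y
  have hbz : b z = T z + B.1 z := congrArg (fun S : E →L[ℂ] F => S z) hb
  have hcz : c z = T z + C.1 z := congrArg (fun S : E →L[ℂ] F => S z) hc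
  have h3 : B.1 z - C.1 z = b z - c z := by rw [hbz, hcz]; abel
  simp only [add_apply, ContinuousLinearMap.comp_apply, sub_apply,
    ContinuousLinearEquiv.coe_coe, ContinuousLinearEquiv.symm_apply_apply]
  rw [h3, map_sub, map_sub, map_sub, b.symm_apply_apply, ← h3]
  abel

/-- After commuting factors, the product is that of the determinants of `(T + B)⁻¹(T + A)` and `(T +
A)⁻¹T`. -/
lemma transition_mul_localSection (A B : TraceClass E F) {T : E →L[ℂ] F}
    (hA : (T + A.1).IsInvertible) (hB : (T + B.1).IsInvertible) :
    transition A B T * localSection A T = localSection B T := by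
  obtain ⟨φ, u, h1, -⟩ := exists_transition_eq A B
  obtain ⟨ψ, w, h2⟩ := A.2.exists_rep
  obtain ⟨a, ha⟩ := hA
  obtain ⟨b, hb⟩ := hB
  rw [transition, localSection, localSection, ← ha, ← hb, ContinuousLinearMap.inverse_equiv,
    ContinuousLinearMap.inverse_equiv, h1.detOneAdd_comp_comm]
  rw [← (h1.comp_left (b.symm : F →L[ℂ] E)).detOneAdd_mul (h2.comp_left (a.symm : F →L[ℂ] E)).neg]
  congr 1
  ext x
  have key : ∀ z, A.1 z - B.1 z = a z - b z := by
    intro z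
    have haz : a z = T z + A.1 z := congrArg (fun S : E →L[ℂ] F => S z) ha
    have hbz : b z = T z + B.1 z := congrArg (fun S : E →L[ℂ] F => S z) hb
    rw [haz, hbz]; abel
  simp only [add_apply, neg_apply, ContinuousLinearMap.comp_apply, sub_apply,
    ContinuousLinearEquiv.coe_coe, map_neg]
  rw [key (a.symm (A.1 x)), map_sub b.symm (a _), a.apply_symm_apply, b.symm_apply_apply,
    map_sub]
  abel

/-- `1 - (T + A)⁻¹A = (T + A)⁻¹T` is invertible exactly when `T` is. -/
lemma localSection_eq_zero_iff (A : TraceClass E F) {T : E →L[ℂ] F}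
    (hA : (T + A.1).IsInvertible) : localSection A T = 0 ↔ ¬ T.IsInvertible := by
  obtain ⟨ψ, w, h⟩ := A.2.exists_rep
  obtain ⟨a, ha⟩ := hA
  rw [← not_iff_not, not_not, localSection, ← ha, ContinuousLinearMap.inverse_equiv]
  refine (h.comp_left (a.symm : F →L[ℂ] E)).neg.detOneAdd_ne_zero_iff.trans ?_
  have h1 : 1 + -((a.symm : F →L[ℂ] E) ∘L A.1) = (a.symm : F →L[ℂ] E) ∘L T := by
    ext x
    have hax : a x = T x + A.1 x := congrArg (fun S : E →L[ℂ] F => S x) ha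
    have : x = a.symm (T x) + a.symm (A.1 x) := by rw [← map_add, ← hax, a.symm_apply_apply]
    change x + -(a.symm (A.1 x)) = a.symm (T x)
    nth_rewrite 1 [this]
    abel
  rw [h1, ← ContinuousLinearMap.isInvertible_equiv_comp (e := a.symm) (f := T)]
  exact isUnit_iff_isInvertible

variable (E F) in
/-- Quillen's determinant line bundle. -/
noncomputable def detLineBundle :
    VectorBundleCore ℂ (FredholmZero E F) ℂ (TraceClass E F) where
  baseSet A := {T | (T.1 + A.1).IsInvertible}
  isOpen_baseSet A := by
    have h : IsOpen {S : E →L[ℂ] F | S.IsInvertible} := ContinuousLinearEquiv.isOpen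
    exact h.preimage (continuous_subtype_val.add continuous_const)
  indexAt T := T.2.exists_add_isInvertible.choose
  mem_baseSet_at T := T.2.exists_add_isInvertible.choose_spec
  coordChange A B T := transition A B T.1 • ContinuousLinearMap.id ℂ ℂ
  coordChange_self A T _ v := by simp [transition_self]
  continuousOn_coordChange A B := by
    have h := (differentiableOn_transition A B).continuousOn
    have h2 : ContinuousOn (fun T : FredholmZero E F => transition A B T.1)
        ({T | (T.1 + A.1).IsInvertible} ∩ {T | (T.1 + B.1).IsInvertible}) :=
      h.comp continuous_subtype_val.continuousOn fun T hT => hT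
    exact h2.smul continuousOn_const
  coordChange_comp A B C T hT v := by
    have := transition_mul_transition A B C hT.1.2 hT.2
    simp only [smul_apply, ContinuousLinearMap.id_apply, smul_eq_mul]
    rw [← mul_assoc, this]

lemma isDeterminantLineBundle_detLineBundle : IsDeterminantLineBundle (detLineBundle E F) where
  baseSet_eq _ := rfl
  coordChange_eq A B T _ z := by simp [detLineBundle]

/-- The canonical section of the determinant line bundle. -/
noncomputable def canonicalSection (T : FredholmZero E F) : (detLineBundle E F).Fiber T :=
  localSection ((detLineBundle E F).indexAt T) T.1

lemma isCanonicalSection_canonicalSection :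
    IsCanonicalSection (detLineBundle E F) canonicalSection := by
  intro A T hT
  have h := isDeterminantLineBundle_detLineBundle.coordChange_eq
    ((detLineBundle E F).indexAt T) A T ⟨(detLineBundle E F).mem_baseSet_at T, hT⟩
    (canonicalSection T)
  refine h.trans ?_
  exact transition_mul_localSection _ A ((detLineBundle E F).mem_baseSet_at T) hT

lemma canonicalSection_eq_zero_iff (T : FredholmZero E F) :
    canonicalSection T = 0 ↔ ¬ T.1.IsInvertible :=
  localSection_eq_zero_iff _ ((detLineBundle E F).mem_baseSet_at T)

end

/-! ### Pull-back along affine maps -/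

section

variable {V : Type*} [AddCommGroup V] [Module ℂ V] [TopologicalSpace V]
variable {G G' : Type*} [NormedAddCommGroup G] [NormedSpace ℂ G] [NormedAddCommGroup G']
  [NormedSpace ℂ G']

lemma hasFDerivAt_const_add_clm (c : G) (L : V →L[ℂ] G) (x : V) :
    HasFDerivAt (fun a => c + L a) L x := by
  rw [hasFDerivAt_iff_isLittleOTVS]
  have : (fun x' => c + L x' - (c + L x) - L (x' - x)) = fun _ => (0 : G) := by
    funext y
    rw [map_sub]
    abel
  rw [this]
  exact Asymptotics.IsLittleOTVS.zero _ _

/-- A chain rule whose source is only a topological vector space, as is needed for the Fréchet space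
`H`. The inner affine map has no remainder, so only that of `g` must be transported. -/
lemma differentiableOn_comp_const_add_clm {g : G → G'} {s : Set G} (hg : DifferentiableOn ℂ g s)
    (c : G) (L : V →L[ℂ] G) :
    DifferentiableOn ℂ (fun a => g (c + L a)) ((fun a => c + L a) ⁻¹' s) := by
  intro x hx
  obtain ⟨g', hg'⟩ := hg _ hx
  refine ⟨g' ∘L L, ?_⟩
  rw [hasFDerivWithinAt_iff_isLittleOTVS] at hg' ⊢
  have ht : Tendsto (fun a => c + L a) (𝓝[(fun a => c + L a) ⁻¹' s] x) (𝓝[s] (c + L x)) :=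
    (continuous_const.add L.continuous).continuousWithinAt.tendsto_nhdsWithin fun _ h => h
  have h1 := hg'.comp_tendsto ht
  have h2 : (fun a => (c + L a) - (c + L x)) =O[ℂ; 𝓝[(fun a => c + L a) ⁻¹' s] x]
      fun a => a - x := by
    have := L.isBigOTVS_comp (f := fun a => a - x) (l := 𝓝[(fun a => c + L a) ⁻¹' s] x)
    refine this.congr_left fun a => ?_
    simp
  have h3 := h1.trans_isBigOTVS h2
  refine h3.congr_left fun a => ?_
  simp

end
end QuillenDet

namespace QuillenDet

/-! ### Norm limits of finite rank operators -/

section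

variable {E : Type*} [NormedAddCommGroup E] [InnerProductSpace ℂ E] [CompleteSpace E]
variable {F : Type*} [NormedAddCommGroup F] [InnerProductSpace ℂ F] [CompleteSpace F]
variable {ι : Type*} {φ : ι → E →L[ℂ] ℂ} {u : ι → E} {K : E →L[ℂ] E}

lemma isCompactOperator_of_tendsto_sum_smulRight
    (hK : Tendsto (fun s : Finset ι => ∑ i ∈ s, (φ i).smulRight (u i)) atTop (𝓝 K)) :
    IsCompactOperator K := by
  refine isCompactOperator_of_tendsto hK (Eventually.of_forall fun s => ?_)
  have h : ∑ i ∈ s, (φ i).smulRight (u i) ∈ compactOperator (RingHom.id ℂ) E E :=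
    sum_mem fun i _ => (isCompactOperator_of_locallyCompactSpace_dom (φ i)).clm_comp
      (ContinuousLinearMap.toSpanSingleton ℂ (u i))
  exact h

lemma hasFiniteRange_sum_smulRight (φ : ι → E →L[ℂ] ℂ) (u : ι → F) (s : Finset ι) :
    ((∑ i ∈ s, (φ i).smulRight (u i) : E →L[ℂ] F) : E →ₗ[ℂ] F).HasFiniteRange := by
  have h : ∑ i ∈ s, ((φ i).smulRight (u i) : E →ₗ[ℂ] F) ∈ LinearMap.finiteRange ℂ E F := by
    refine sum_mem fun i _ => ?_
    rw [LinearMap.mem_finiteRange_iff_hasFiniteRange]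
    exact (LinearMap.HasFiniteRange.of_finite_dom
      (f := LinearMap.toSpanSingleton ℂ F (u i))).comp_right (φ i : E →ₗ[ℂ] ℂ)
  have h2 : (∑ i ∈ s, ((φ i).smulRight (u i) : E →ₗ[ℂ] F)) =
      ((∑ i ∈ s, (φ i).smulRight (u i) : E →L[ℂ] F) : E →ₗ[ℂ] F) := by
    ext x
    simp
  rw [h2, LinearMap.mem_finiteRange_iff_hasFiniteRange] at h
  exact h

lemma exists_norm_sub_lt
    (hK : Tendsto (fun s : Finset ι => ∑ i ∈ s, (φ i).smulRight (u i)) atTop (𝓝 K))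
    {ε : ℝ} (hε : 0 < ε) : ∃ s : Finset ι, ‖K - ∑ i ∈ s, (φ i).smulRight (u i)‖ < ε := by
  have h := ((tendsto_const_nhds (x := K)).sub hK).norm
  rw [sub_self, norm_zero] at h
  exact (h.eventually (gt_mem_nhds hε)).exists

lemma isUnit_one_add_of_norm_lt {S : E →L[ℂ] E} (h : ‖S‖ < 1) : IsUnit (1 + S) := by
  have := isUnit_one_sub_of_norm_lt_one (x := -S) (by rwa [norm_neg])
  rwa [sub_neg_eq_add] at this

/-- A finite sum within distance one of `K` splits `V(1 + K)` into an invertible operator plus one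
of finite rank. -/
lemma isFredholmZero_comp_one_add (V : E ≃L[ℂ] F)
    (hK : Tendsto (fun s : Finset ι => ∑ i ∈ s, (φ i).smulRight (u i)) atTop (𝓝 K)) :
    IsFredholmZero (V.toContinuousLinearMap ∘L (1 + K)) := by
  obtain ⟨s, hs⟩ := exists_norm_sub_lt hK one_pos
  obtain ⟨e, he⟩ := isUnit_iff_isInvertible.mp (isUnit_one_add_of_norm_lt hs)
  have h := isFredholmZero_equiv_add (e.trans V)
    (A := V.toContinuousLinearMap ∘L ∑ i ∈ s, (φ i).smulRight (u i))
    ((hasFiniteRange_sum_smulRight φ u s).comp_left (V : E →ₗ[ℂ] F))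
  convert h using 1
  ext x
  have hx : e x = x + (K x - (∑ i ∈ s, (φ i).smulRight (u i)) x) :=
    congrArg (fun S : E →L[ℂ] E => S x) he
  change V (x + K x) = V (e x) + V ((∑ i ∈ s, (φ i).smulRight (u i)) x)
  rw [hx, ← map_add]
  congr 1
  abel

/-- For a norm limit `K` of finite rank operators, the parameters `t` for which `1 + tK` is not
invertible are isolated. -/
lemma eventually_isUnit_one_add_smul
    (hK : Tendsto (fun s : Finset ι => ∑ i ∈ s, (φ i).smulRight (u i)) atTop (𝓝 K)) (t₀ : ℂ) :
    ∀ᶠ t in 𝓝[≠] t₀, IsUnit (1 + t • K) := by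
  classical
  -- The ball of radius `R` contains both `t₀` and `0`. Choosing `‖S‖ < R⁻¹` makes `1 + tS`
  -- invertible throughout it.
  set R : ℝ := ‖t₀‖ + 1
  have hR : 0 < R := by positivity
  obtain ⟨s, hs⟩ := exists_norm_sub_lt hK (inv_pos.mpr hR)
  set Fs : E →L[ℂ] E := ∑ i ∈ s, (φ i).smulRight (u i) with hFs
  set S : E →L[ℂ] E := K - Fs with hS
  have hunit : ∀ t ∈ Metric.ball (0 : ℂ) R, IsUnit (1 + t • S) := by
    intro t ht
    rw [mem_ball_zero_iff] at ht
    refine isUnit_one_add_of_norm_lt ?_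
    rw [norm_smul]
    calc ‖t‖ * ‖S‖ ≤ R * ‖S‖ := by gcongr
      _ < R * R⁻¹ := by gcongr
      _ = 1 := mul_inv_cancel₀ hR.ne'
  -- From `1 + tK = (1 + tS)(1 + (1 + tS)⁻¹ tF)`, invertibility can fail only at zeros of this
  -- holomorphic finite determinant.
  let D : ℂ → ℂ := fun t => Matrix.det
    (1 + Matrix.of fun i j : s => φ i (Ring.inverse (1 + t • S) (t • u j)))
  have hD : DifferentiableOn ℂ D (Metric.ball 0 R) := by
    intro t ht
    have h1 : DifferentiableAt ℂ (fun t : ℂ => Ring.inverse (1 + t • S)) t :=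
      (differentiableAt_inverse (𝕜 := ℂ) (hunit t ht)).comp t (f := fun t : ℂ => 1 + t • S)
        ((differentiableAt_id.smul_const S).const_add 1)
    have h2 : ∀ i j : s, DifferentiableAt ℂ
        (fun t : ℂ => φ i (Ring.inverse (1 + t • S) (t • u j))) t := fun i j =>
      (φ i).differentiableAt.comp t (h1.clm_apply (differentiableAt_id.smul_const (u j)))
    simp only [D, Matrix.det_apply', Matrix.add_apply, Matrix.of_apply]
    refine DifferentiableAt.differentiableWithinAt ?_
    fun_prop
  have hD0 : D 0 = 1 := by
    have : (Matrix.of fun i j : s => φ i (Ring.inverse (1 + (0 : ℂ) • S) ((0 : ℂ) • u j))) = 0 := by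
      ext i j
      simp
    simp only [D, this, add_zero, Matrix.det_one]
  have hana := hD.analyticOnNhd Metric.isOpen_ball
  have ht₀ : t₀ ∈ Metric.ball (0 : ℂ) R := by
    rw [mem_ball_zero_iff]
    simp [R]
  -- Zeros accumulating at `t₀` would force `D = 0` on the whole ball, against `D 0 = 1`.
  have hne : ∀ᶠ t in 𝓝[≠] t₀, D t ≠ 0 := by
    by_contra hcon
    have hfreq : ∃ᶠ t in 𝓝[≠] t₀, D t = 0 :=
      (Filter.not_eventually.mp hcon).mono fun t ht => not_not.mp ht
    have := hana.eqOn_zero_of_preconnected_of_frequently_eq_zero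
      (convex_ball _ _).isPreconnected ht₀ hfreq (Metric.mem_ball_self hR)
    rw [hD0] at this
    exact one_ne_zero this
  have hball : ∀ᶠ t in 𝓝[≠] t₀, t ∈ Metric.ball (0 : ℂ) R :=
    nhdsWithin_le_nhds (Metric.isOpen_ball.mem_nhds ht₀)
  filter_upwards [hne, hball] with t ht hbt
  have hU := hunit t hbt
  have hrep := ((IsNuclearRep.sum_finset φ u s).comp_left (t • ContinuousLinearMap.id ℂ E)).comp_left
    (Ring.inverse (1 + t • S))
  have h1 := isUnit_of_one_add_matrix hrep ht
  have h2 : 1 + t • K = (1 + t • S) * (1 + Ring.inverse (1 + t • S) ∘L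
      ((t • ContinuousLinearMap.id ℂ E) ∘L Fs)) := by
    have h3 : (t • ContinuousLinearMap.id ℂ E) ∘L Fs = t • Fs := by
      ext x; simp
    rw [h3, mul_add, mul_one]
    change _ = 1 + t • S + (1 + t • S) * (Ring.inverse (1 + t • S) * (t • Fs))
    rw [← mul_assoc, Ring.mul_inverse_cancel _ hU, one_mul, hS, smul_sub]
    abel
  rw [h2]
  exact hU.mul h1

end
end QuillenDet

namespace NCTorus

/-! ### Weighted composition operators on `ℓ²(ℤ² \ {0})` -/

/-- The Hilbert space `ℓ²(ℤ² \ {0})`. -/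
abbrev Ell2 : Type := lp (fun _ : PuncturedLattice => ℂ) 2

/-- Extension by zero from `ℤ² \ {0}` to `ℤ²`. -/
noncomputable def zeroExtend (x : PuncturedLattice → ℂ) : ℤ × ℤ → ℂ :=
  fun v => if h : v ≠ 0 then x ⟨v, h⟩ else 0

@[simp] lemma zeroExtend_coe (x : PuncturedLattice → ℂ) (v : PuncturedLattice) :
    zeroExtend x v.1 = x v := dif_pos v.2

@[simp] lemma zeroExtend_zero (x : PuncturedLattice → ℂ) : zeroExtend x 0 = 0 :=
  dif_neg (not_not.mpr rfl)

lemma zeroExtend_add (x y : PuncturedLattice → ℂ) (v : ℤ × ℤ) :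
    zeroExtend (x + y) v = zeroExtend x v + zeroExtend y v := by
  unfold zeroExtend
  split_ifs <;> simp

lemma zeroExtend_smul (c : ℂ) (x : PuncturedLattice → ℂ) (v : ℤ × ℤ) :
    zeroExtend (c • x) v = c * zeroExtend x v := by
  unfold zeroExtend
  split_ifs <;> simp

lemma summable_norm_sq (x : Ell2) : Summable fun v => ‖x v‖ ^ 2 := by
  simpa using (lp.memℓp x).summable (by norm_num)

lemma norm_sq_eq_tsum (x : Ell2) : ‖x‖ ^ 2 = ∑' v, ‖x v‖ ^ 2 := by
  simpa using lp.norm_rpow_eq_tsum (p := 2) (by norm_num) x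

lemma zeroExtend_eq_zero_of_notMem (x : PuncturedLattice → ℂ) (v : ℤ × ℤ)
    (hv : v ∉ Set.range (Subtype.val : PuncturedLattice → ℤ × ℤ)) : ‖zeroExtend x v‖ ^ 2 = 0 := by
  have : v = 0 := by
    by_contra h
    exact hv ⟨⟨v, h⟩, rfl⟩
  simp [this]

lemma summable_zeroExtend (x : Ell2) : Summable fun v => ‖zeroExtend x v‖ ^ 2 := by
  refine (Subtype.val_injective.summable_iff (zeroExtend_eq_zero_of_notMem x)).mp ?_
  simpa [Function.comp_def] using summable_norm_sq x

lemma tsum_zeroExtend (x : Ell2) : ∑' v, ‖zeroExtend x v‖ ^ 2 = ‖x‖ ^ 2 := by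
  rw [norm_sq_eq_tsum, ← Subtype.val_injective.tsum_eq (f := fun v => ‖zeroExtend x v‖ ^ 2)
    (Function.support_subset_iff'.mpr (zeroExtend_eq_zero_of_notMem x))]
  simp

lemma norm_zeroExtend_le (x : Ell2) (v : ℤ × ℤ) : ‖zeroExtend x v‖ ≤ ‖x‖ := by
  unfold zeroExtend
  split_ifs with h
  · exact lp.norm_apply_le_norm (by norm_num) x ⟨v, h⟩
  · simp

section

variable {σ : PuncturedLattice → ℤ × ℤ} {c : PuncturedLattice → ℂ} {C : ℝ}

lemma norm_sq_mul_zeroExtend_le (hC : ∀ v, ‖c v‖ ≤ C) (x : Ell2) (v : PuncturedLattice) :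
    ‖c v * zeroExtend x (σ v)‖ ^ 2 ≤ C ^ 2 * ‖zeroExtend x (σ v)‖ ^ 2 := by
  rw [norm_mul, mul_pow]
  gcongr
  exact hC v

lemma summable_mul_zeroExtend (hσ : Function.Injective σ) (hC : ∀ v, ‖c v‖ ≤ C) (x : Ell2) :
    Summable fun v => ‖c v * zeroExtend x (σ v)‖ ^ 2 :=
  Summable.of_nonneg_of_le (fun _ => by positivity) (norm_sq_mul_zeroExtend_le hC x)
    (((summable_zeroExtend x).comp_injective hσ).mul_left _)

/-- The operator `(x_v) ↦ (c_v x_{σ v})` on `ℓ²(ℤ² \ {0})`. -/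
noncomputable def weightedComp (σ : PuncturedLattice → ℤ × ℤ) (hσ : Function.Injective σ)
    (c : PuncturedLattice → ℂ) (C : ℝ) (hC0 : 0 ≤ C) (hC : ∀ v, ‖c v‖ ≤ C) : Ell2 →L[ℂ] Ell2 :=
  LinearMap.mkContinuous
    { toFun := fun x => ⟨fun v => c v * zeroExtend x (σ v), memℓp_gen (by
        simpa using summable_mul_zeroExtend hσ hC x)⟩
      map_add' := fun x y => by
        ext v
        change c v * zeroExtend (x + y : Ell2) (σ v) =
          c v * zeroExtend x (σ v) + c v * zeroExtend y (σ v)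
        rw [lp.coeFn_add, zeroExtend_add, mul_add]
      map_smul' := fun a x => by
        ext v
        change c v * zeroExtend (a • x : Ell2) (σ v) = a * (c v * zeroExtend x (σ v))
        rw [lp.coeFn_smul, zeroExtend_smul, mul_left_comm] } C fun x => by
    refine le_of_sq_le_sq ?_ (by positivity)
    rw [norm_sq_eq_tsum, mul_pow, ← tsum_zeroExtend, ← tsum_mul_left]
    have h1 := (summable_zeroExtend x).mul_left (C ^ 2)
    refine (Summable.tsum_le_tsum (norm_sq_mul_zeroExtend_le hC x)
      (summable_mul_zeroExtend hσ hC x) (h1.comp_injective hσ)).trans ?_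
    exact tsum_comp_le_tsum_of_inj h1 (fun _ => by positivity) hσ

lemma weightedComp_apply (hσ : Function.Injective σ) (hC0 : 0 ≤ C) (hC : ∀ v, ‖c v‖ ≤ C)
    (x : Ell2) (v : PuncturedLattice) :
    weightedComp σ hσ c C hC0 hC x v = c v * zeroExtend x (σ v) := rfl

lemma norm_weightedComp_le (hσ : Function.Injective σ) (hC0 : 0 ≤ C) (hC : ∀ v, ‖c v‖ ≤ C) :
    ‖weightedComp σ hσ c C hC0 hC‖ ≤ C := LinearMap.mkContinuous_norm_le _ hC0 _

end

/-- The diagonal operator on `ℓ²(ℤ² \ {0})` with bounded entries `c`. -/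
noncomputable def diagOp (c : PuncturedLattice → ℂ) (C : ℝ) (hC0 : 0 ≤ C) (hC : ∀ v, ‖c v‖ ≤ C) :
    Ell2 →L[ℂ] Ell2 := weightedComp Subtype.val Subtype.val_injective c C hC0 hC

lemma diagOp_apply {c : PuncturedLattice → ℂ} {C : ℝ} (hC0 : 0 ≤ C) (hC : ∀ v, ‖c v‖ ≤ C)
    (x : Ell2) (v : PuncturedLattice) : diagOp c C hC0 hC x v = c v * x v := by
  rw [diagOp, weightedComp_apply, zeroExtend_coe]

/-- A diagonal operator whose entries tend to zero is a norm limit of finite rank operators. -/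
lemma tendsto_sum_smulRight_diagOp {c : PuncturedLattice → ℂ} {C : ℝ} (hC0 : 0 ≤ C)
    (hC : ∀ v, ‖c v‖ ≤ C) (hc : Tendsto c cofinite (𝓝 0)) :
    Tendsto (fun s : Finset PuncturedLattice => ∑ v ∈ s,
      (lp.evalCLM ℂ (fun _ : PuncturedLattice => ℂ) 2 v).smulRight (lp.single 2 v (c v) : Ell2))
      atTop (𝓝 (diagOp c C hC0 hC)) := by
  classical
  rw [Metric.tendsto_atTop]
  intro ε hε
  -- Once the finitely many large entries are removed, the remainder is a diagonal operator of norm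
  -- at most `ε / 2`.
  have hfin : {v | ¬ ‖c v‖ < ε / 2}.Finite := by
    have := hc.norm
    rw [norm_zero] at this
    exact this.eventually (gt_mem_nhds (half_pos hε))
  refine ⟨hfin.toFinset, fun s hs => ?_⟩
  rw [dist_comm, dist_eq_norm]
  have hb : ∀ v, ‖if v ∈ s then 0 else c v‖ ≤ ε / 2 := by
    intro v
    split_ifs with h
    · rw [norm_zero]; exact (half_pos hε).le
    · by_contra hcon
      exact h (hs (hfin.mem_toFinset.mpr fun h' => hcon h'.le))
  have h1 : diagOp c C hC0 hC - ∑ v ∈ s, (lp.evalCLM ℂ (fun _ : PuncturedLattice => ℂ) 2 v).smulRight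
      (lp.single 2 v (c v) : Ell2) =
      diagOp (fun v => if v ∈ s then 0 else c v) (ε / 2) (half_pos hε).le hb := by
    ext x w
    rw [diagOp_apply, sub_apply, lp.coeFn_sub, Pi.sub_apply, diagOp_apply, sum_apply,
      lp.coeFn_sum, Finset.sum_apply]
    have h2 : ∀ v ∈ s, ((lp.evalCLM ℂ (fun _ : PuncturedLattice => ℂ) 2 v).smulRight
        (lp.single 2 v (c v) : Ell2) x : Ell2) w = if w = v then c w * x w else 0 := by
      intro v _
      change x v • (lp.single 2 v (c v) : Ell2) w = _
      split_ifs with h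
      · subst h
        rw [lp.single_apply_self, smul_eq_mul, mul_comm]
      · rw [lp.single_apply_ne _ _ _ h, smul_zero]
    rw [Finset.sum_congr rfl h2, Finset.sum_ite_eq]
    split_ifs <;> simp
  rw [h1]
  exact (norm_weightedComp_le _ _ _).trans_lt (half_lt_self hε)

/-! ### The eigenvalues of `δ_τ` -/

/-- Ellipticity of `δ_τ`: the imaginary part of `mτ + n` controls `m`, and then `n` is controlled
too. Excluding the origin lets `|m| + |n| ≥ 1` absorb the constant in `size`, whence the factor 2.
-/
lemma exists_size_le_norm_iota {τ : ℂ} (hτ : τ.im ≠ 0) :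
    ∃ c : ℝ, 0 < c ∧ ∀ v : ℤ × ℤ, v ≠ 0 → size v ≤ c * ‖iota τ v‖ := by
  have him : 0 < |τ.im| := abs_pos.mpr hτ
  have hpi := Real.pi_gt_three
  refine ⟨2 * (1 + (1 + ‖τ‖) / |τ.im|), by positivity, fun v hv => ?_⟩
  set z : ℂ := (v.1 : ℂ) * τ + v.2 with hz
  have hiota : ‖iota τ v‖ = 2 * Real.pi * ‖z‖ := by
    rw [iota, norm_mul]
    congr 1
    simp [abs_of_pos Real.pi_pos]
  have h1 : |(v.1 : ℝ)| * |τ.im| ≤ ‖z‖ := by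
    have := Complex.abs_im_le_norm z
    rw [hz] at this
    simpa [abs_mul] using this
  have h2 : |(v.2 : ℝ)| ≤ ‖z‖ + |(v.1 : ℝ)| * ‖τ‖ := by
    have h3 : (v.2 : ℂ) = z - v.1 * τ := by rw [hz]; ring
    have h4 := norm_sub_le z (v.1 * τ)
    rw [← h3, norm_mul, Complex.norm_intCast, Complex.norm_intCast] at h4
    exact h4
  have h3 : |(v.1 : ℝ)| ≤ ‖z‖ / |τ.im| := by rwa [le_div_iff₀ him]
  have h4 : 1 ≤ |(v.1 : ℝ)| + |(v.2 : ℝ)| := by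
    by_cases h : v.1 = 0
    · have h' : v.2 ≠ 0 := fun h' => hv (Prod.ext h h')
      have : (1 : ℝ) ≤ |(v.2 : ℝ)| := by exact_mod_cast Int.one_le_abs h'
      linarith [abs_nonneg (v.1 : ℝ)]
    · have : (1 : ℝ) ≤ |(v.1 : ℝ)| := by exact_mod_cast Int.one_le_abs h
      linarith [abs_nonneg (v.2 : ℝ)]
  have h5 : size v ≤ 2 * (|(v.1 : ℝ)| + |(v.2 : ℝ)|) := by unfold size; linarith
  have h6 : |(v.1 : ℝ)| + |(v.2 : ℝ)| ≤ (1 + (1 + ‖τ‖) / |τ.im|) * ‖z‖ := by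
    calc |(v.1 : ℝ)| + |(v.2 : ℝ)| ≤ ‖z‖ + |(v.1 : ℝ)| * (1 + ‖τ‖) := by linarith
      _ ≤ ‖z‖ + ‖z‖ / |τ.im| * (1 + ‖τ‖) := by gcongr
      _ = (1 + (1 + ‖τ‖) / |τ.im|) * ‖z‖ := by ring
  have h7 : ‖z‖ ≤ ‖iota τ v‖ := by
    rw [hiota]
    nlinarith [norm_nonneg z]
  calc size v ≤ 2 * ((1 + (1 + ‖τ‖) / |τ.im|) * ‖z‖) := h5.trans (by gcongr)
    _ ≤ 2 * ((1 + (1 + ‖τ‖) / |τ.im|) * ‖iota τ v‖) := by gcongr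
    _ = _ := by ring

lemma iota_ne_zero {τ : ℂ} (hτ : τ.im ≠ 0) {v : ℤ × ℤ} (hv : v ≠ 0) : iota τ v ≠ 0 := by
  obtain ⟨c, hc, h⟩ := exists_size_le_norm_iota hτ
  intro h0
  have := h v hv
  rw [h0, norm_zero, mul_zero] at this
  exact absurd (size_pos v) (not_lt.mpr this)

lemma norm_iota_inv_le {τ : ℂ} {c : ℝ} (hτ : τ.im ≠ 0)
    (h : ∀ v : ℤ × ℤ, v ≠ 0 → size v ≤ c * ‖iota τ v‖) (v : PuncturedLattice) :
    ‖(iota τ v.1)⁻¹‖ ≤ c * (size v.1)⁻¹ := by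
  have h1 := h v.1 v.2
  have h2 : 0 < ‖iota τ v.1‖ := norm_pos_iff.mpr (iota_ne_zero hτ v.2)
  rw [norm_inv, inv_eq_one_div, ← div_eq_mul_inv, div_le_div_iff₀ h2 (size_pos v.1), one_mul]
  exact h1

lemma exists_norm_iota_inv_le {τ : ℂ} (hτ : τ.im ≠ 0) :
    ∃ C : ℝ, 0 ≤ C ∧ ∀ v : PuncturedLattice, ‖(iota τ v.1)⁻¹‖ ≤ C := by
  obtain ⟨c, hc, h⟩ := exists_size_le_norm_iota hτ
  refine ⟨c, hc.le, fun v => (norm_iota_inv_le hτ h v).trans ?_⟩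
  exact mul_le_of_le_one_right hc.le (inv_le_one_of_one_le₀ (one_le_size v.1))

lemma tendsto_iota_inv {τ : ℂ} (hτ : τ.im ≠ 0) :
    Tendsto (fun v : PuncturedLattice => (iota τ v.1)⁻¹) cofinite (𝓝 0) := by
  obtain ⟨c, hc, h⟩ := exists_size_le_norm_iota hτ
  have h1 : Tendsto (fun v : PuncturedLattice => (size v.1 ^ 4)⁻¹) cofinite (𝓝 0) :=
    (summable_size_inv.subtype {v | v ≠ 0}).tendsto_cofinite_zero
  have h2 : Tendsto (fun v : PuncturedLattice => c * (size v.1)⁻¹) cofinite (𝓝 0) := by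
    -- Summability gives decay of the inverse fourth power. Two square roots recover the first
    -- power.
    have h3 := ((Real.continuous_sqrt.comp Real.continuous_sqrt).tendsto 0).comp h1
    simp only [Function.comp_apply, Real.sqrt_zero] at h3
    have h4 := h3.const_mul c
    rw [mul_zero] at h4
    refine h4.congr fun v => ?_
    have hs := size_pos v.1
    have h5 : (size v.1 ^ 4)⁻¹ = (((size v.1)⁻¹) ^ 2) ^ 2 := by
      rw [← pow_mul, inv_pow]
    simp only [Function.comp_apply]
    rw [h5, Real.sqrt_sq (by positivity), Real.sqrt_sq (by positivity)]
  exact squeeze_zero_norm (norm_iota_inv_le hτ h) h2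

end NCTorus

lemma QuillenDet.tendsto_sum_smulRight_comp {E E' F F' ι : Type*}
    [NormedAddCommGroup E] [NormedSpace ℂ E] [NormedAddCommGroup E'] [NormedSpace ℂ E']
    [NormedAddCommGroup F] [NormedSpace ℂ F] [NormedAddCommGroup F'] [NormedSpace ℂ F']
    {φ : ι → E →L[ℂ] ℂ} {u : ι → F} {K : E →L[ℂ] F}
    (hK : Tendsto (fun s : Finset ι => ∑ i ∈ s, (φ i).smulRight (u i)) atTop (𝓝 K))
    (X : F →L[ℂ] F') (Y : E' →L[ℂ] E) :
    Tendsto (fun s : Finset ι => ∑ i ∈ s, (φ i ∘L Y).smulRight (X (u i))) atTop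
      (𝓝 (X ∘L K ∘L Y)) := by
  have h := (((ContinuousLinearMap.compL ℂ E' F F' X).continuous.comp
    ((ContinuousLinearMap.compL ℂ E' E F).flip Y).continuous).tendsto K).comp hK
  refine h.congr fun s => ?_
  ext x
  simp

namespace NCTorus

variable {θ : ℝ} {τ : ℂ}

/-! ### The operator `ad(a)` on `ℓ²` -/

/-- The coefficient of `U^v` in the commutator of `U^u` and `U^(v - u)`. -/
noncomputable def commPhase (θ : ℝ) (u v : ℤ × ℤ) : ℂ :=
  SmoothNCTorus.phase θ u (v - u) - SmoothNCTorus.phase θ (v - u) u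

lemma norm_commPhase_le (θ : ℝ) (u v : ℤ × ℤ) : ‖commPhase θ u v‖ ≤ 2 := by
  refine (norm_sub_le _ _).trans ?_
  rw [SmoothNCTorus.norm_phase, SmoothNCTorus.norm_phase]
  norm_num

/-- `U^u` and `U^(-u)` commute, so commutators have trace zero and `ad(a)` preserves `H`. -/
lemma commPhase_zero (θ : ℝ) (u : ℤ × ℤ) : commPhase θ u 0 = 0 := by
  rw [commPhase, sub_eq_zero, SmoothNCTorus.phase, SmoothNCTorus.phase]
  congr 1
  simp

lemma commPhase_self (θ : ℝ) (u : ℤ × ℤ) : commPhase θ u u = 0 := by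
  simp [commPhase, SmoothNCTorus.phase]

lemma hasSum_ad_apply (a x : SmoothNCTorus θ) (v : ℤ × ℤ) :
    HasSum (fun u => a u * commPhase θ u v * x (v - u)) (ad a x v) := by
  have h1 : HasSum (fun u => a u * x (v - u) * SmoothNCTorus.phase θ u (v - u)) ((a * x) v) :=
    (SmoothNCTorus.summable_term a x v).hasSum
  have h2 : HasSum (fun u => x u * a (v - u) * SmoothNCTorus.phase θ u (v - u)) ((x * a) v) :=
    (SmoothNCTorus.summable_term x a v).hasSum
  -- The substitution `u ↦ v - u` writes both products as sums against the coefficient `a u`.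
  rw [← (Equiv.subLeft v).hasSum_iff] at h2
  have h3 : ad a x v = (a * x) v - (x * a) v := rfl
  rw [h3]
  convert! h1.sub h2 using 1
  funext u
  simp only [commPhase, Function.comp_apply, Equiv.subLeft_apply, sub_sub_cancel]
  ring

lemma ad_apply_zero (a x : SmoothNCTorus θ) : ad a x 0 = 0 := by
  refine (hasSum_ad_apply a x 0).unique ?_
  simp only [commPhase_zero, mul_zero, zero_mul]
  exact hasSum_zero

/-- The commutator with `U^u`, as an operator on `ℓ²`. -/
noncomputable def adTerm (θ : ℝ) (u : ℤ × ℤ) : Ell2 →L[ℂ] Ell2 :=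
  weightedComp (fun v => v.1 - u) (fun _ _ h => Subtype.ext (sub_left_injective h))
    (fun v => commPhase θ u v.1) 2 zero_le_two fun v => norm_commPhase_le θ u v.1

lemma norm_smul_adTerm_le (a : SmoothNCTorus θ) (u : ℤ × ℤ) :
    ‖a u • adTerm θ u‖ ≤ 2 * ‖a u‖ := by
  rw [norm_smul, mul_comm]
  gcongr
  exact norm_weightedComp_le _ _ _

lemma summable_norm (a : SmoothNCTorus θ) : Summable fun v => ‖a v‖ := by
  simpa using a.summable_weighted 0

lemma summable_norm_adTerm (a : SmoothNCTorus θ) : Summable fun u => ‖a u • adTerm θ u‖ :=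
  Summable.of_nonneg_of_le (fun _ => norm_nonneg _) (norm_smul_adTerm_le a)
    ((summable_norm a).mul_left 2)

lemma summable_adTerm (a : SmoothNCTorus θ) : Summable fun u => a u • adTerm θ u :=
  (summable_norm_adTerm a).of_norm

/-- The operator `ad(a)` on `ℓ²`. -/
noncomputable def adEll2 (θ : ℝ) : SmoothNCTorus θ →ₗ[ℂ] Ell2 →L[ℂ] Ell2 where
  toFun a := ∑' u, a u • adTerm θ u
  map_add' a b := by
    rw [← (summable_adTerm a).tsum_add (summable_adTerm b)]
    exact tsum_congr fun u => add_smul (a u) (b u) _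
  map_smul' c a := by
    rw [RingHom.id_apply, ← (summable_adTerm a).tsum_const_smul c]
    exact tsum_congr fun u => mul_smul c (a u) _

lemma norm_adEll2_le (a : SmoothNCTorus θ) : ‖adEll2 θ a‖ ≤ 2 * ∑' u, ‖a u‖ := by
  refine (norm_tsum_le_tsum_norm (summable_norm_adTerm a)).trans ?_
  rw [← tsum_mul_left]
  exact Summable.tsum_le_tsum (norm_smul_adTerm_le a) (summable_norm_adTerm a)
    ((summable_norm a).mul_left 2)

lemma hasSum_adEll2_apply (a : SmoothNCTorus θ) (x : Ell2) (v : PuncturedLattice) :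
    HasSum (fun u => a u * commPhase θ u v.1 * zeroExtend x (v.1 - u)) (adEll2 θ a x v) := by
  have h := ((summable_adTerm a).hasSum.mapL (ContinuousLinearMap.apply ℂ Ell2 x)).mapL
    (lp.evalCLM ℂ (fun _ : PuncturedLattice => ℂ) 2 v)
  convert! h using 1
  funext u
  exact mul_assoc _ _ _

/-! ### The extensions of `δ_τ` and `ad(a)` -/

/-- The isometry `W_s(H) ≃ ℓ²`. -/
noncomputable def toEll2 (τ : ℂ) (s : ℤ) : SobolevH τ s ≃ₗᵢ[ℂ] Ell2 :=
  { SobolevH.toL2 τ s with norm_map' := fun _ => rfl }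

lemma toEll2_zero_apply (x : SobolevH τ 0) (v : PuncturedLattice) : toEll2 τ 0 x v = x v := by
  change ((sobolevWeight τ v.1 ^ (0 : ℤ) : ℝ)) • x v = x v
  rw [zpow_zero, one_smul]

lemma coe_toEll2_zero (x : SobolevH τ 0) : (toEll2 τ 0 x : PuncturedLattice → ℂ) = x :=
  funext (toEll2_zero_apply x)

lemma toEll2_zero_symm_apply (y : Ell2) (v : PuncturedLattice) :
    (toEll2 τ 0).symm y v = y v := by
  rw [← toEll2_zero_apply, LinearIsometryEquiv.apply_symm_apply]

lemma toEll2_neg_one_symm_apply (y : Ell2) (v : PuncturedLattice) :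
    (toEll2 τ (-1)).symm y v = sobolevWeight τ v.1 * y v := by
  change ((sobolevWeight τ v.1 ^ (-1 : ℤ))⁻¹ : ℝ) • y v = _
  rw [zpow_neg_one, inv_inv, Complex.real_smul]

lemma norm_iota_le_sobolevWeight (τ : ℂ) (v : ℤ × ℤ) : ‖iota τ v‖ ≤ sobolevWeight τ v := by
  refine Real.le_sqrt_of_sq_le ?_
  linarith

lemma sobolevWeight_le (τ : ℂ) (v : ℤ × ℤ) : sobolevWeight τ v ≤ 1 + ‖iota τ v‖ := by
  refine Real.sqrt_le_iff.mpr ⟨by positivity, ?_⟩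
  nlinarith [norm_nonneg (iota τ v)]

lemma sobolevWeight_ne_zero (τ : ℂ) (v : ℤ × ℤ) : (sobolevWeight τ v : ℂ) ≠ 0 := by
  exact_mod_cast (sobolevWeight_pos τ v).ne'

lemma norm_iota_mul_inv_sobolevWeight_le (τ : ℂ) (v : ℤ × ℤ) :
    ‖iota τ v * (sobolevWeight τ v : ℂ)⁻¹‖ ≤ 1 := by
  rw [norm_mul, norm_inv, Complex.norm_real, Real.norm_of_nonneg (sobolevWeight_pos τ v).le,
    ← div_eq_mul_inv, div_le_one (sobolevWeight_pos τ v)]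
  exact norm_iota_le_sobolevWeight τ v

/-- The diagonal operator with entries `2πi(mτ + n) / (1 + |2πi(mτ + n)|²)^{1/2}`. -/
noncomputable def iotaEquiv (hτ : τ.im ≠ 0) : Ell2 ≃L[ℂ] Ell2 :=
  -- The weight is at most `1 + |2πi(mτ + n)|`, so the inverse entries are bounded by the bound for
  -- `iota⁻¹` plus one.
  have h2 : ∀ v : PuncturedLattice, ‖(iota τ v.1)⁻¹ * (sobolevWeight τ v.1 : ℂ)‖ ≤
      (exists_norm_iota_inv_le hτ).choose + 1 := fun v => by
    have h3 := (exists_norm_iota_inv_le hτ).choose_spec.2 v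
    have h4 : 0 < ‖iota τ v.1‖ := norm_pos_iff.mpr (iota_ne_zero hτ v.2)
    rw [norm_mul, Complex.norm_real, Real.norm_of_nonneg (sobolevWeight_pos τ v.1).le]
    calc ‖(iota τ v.1)⁻¹‖ * sobolevWeight τ v.1
        ≤ ‖(iota τ v.1)⁻¹‖ * (1 + ‖iota τ v.1‖) := by
          gcongr; exact sobolevWeight_le τ v.1
      _ = ‖(iota τ v.1)⁻¹‖ + 1 := by
          rw [mul_add, mul_one, norm_inv, inv_mul_cancel₀ h4.ne']
      _ ≤ _ := by gcongr
  ContinuousLinearEquiv.equivOfInverse (diagOp _ 1 zero_le_one fun v => norm_iota_mul_inv_sobolevWeight_le τ v.1)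
    (diagOp _ _ (add_nonneg (exists_norm_iota_inv_le hτ).choose_spec.1 zero_le_one) h2)
    (fun x => by
      ext v
      rw [diagOp_apply, diagOp_apply]
      have := iota_ne_zero hτ v.2
      have := sobolevWeight_ne_zero τ v.1
      field_simp)
    (fun x => by
      ext v
      rw [diagOp_apply, diagOp_apply]
      have := iota_ne_zero hτ v.2
      have := sobolevWeight_ne_zero τ v.1
      field_simp)

lemma iotaEquiv_apply (hτ : τ.im ≠ 0) (x : Ell2) (v : PuncturedLattice) :
    iotaEquiv hτ x v = iota τ v.1 * (sobolevWeight τ v.1 : ℂ)⁻¹ * x v :=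
  diagOp_apply zero_le_one (fun v => norm_iota_mul_inv_sobolevWeight_le τ v.1) x v

/-- The extension of `δ_τ` to an isomorphism `W_0(H) → W_{-1}(H)`. -/
noncomputable def deltaEquiv (hτ : τ.im ≠ 0) : SobolevH τ 0 ≃L[ℂ] SobolevH τ (-1) :=
  (toEll2 τ 0).toContinuousLinearEquiv.trans
    ((iotaEquiv hτ).trans (toEll2 τ (-1)).symm.toContinuousLinearEquiv)

lemma deltaEquiv_apply (hτ : τ.im ≠ 0) (x : SobolevH τ 0) (v : PuncturedLattice) :
    deltaEquiv hτ x v = iota τ v.1 * x v := by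
  change (toEll2 τ (-1)).symm (iotaEquiv hτ (toEll2 τ 0 x)) v = _
  rw [toEll2_neg_one_symm_apply, iotaEquiv_apply, toEll2_zero_apply]
  have := sobolevWeight_ne_zero τ v.1
  field_simp

/-- The inclusion `ℓ² = W_0(H) → W_{-1}(H)`. -/
noncomputable def inclNegOne (τ : ℂ) : Ell2 →L[ℂ] SobolevH τ (-1) :=
  (toEll2 τ (-1)).symm.toContinuousLinearEquiv.toContinuousLinearMap ∘L
    diagOp (fun v => (sobolevWeight τ v.1 : ℂ)⁻¹) 1 zero_le_one fun v => by
      rw [norm_inv, Complex.norm_real, Real.norm_of_nonneg (sobolevWeight_pos τ v.1).le]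
      exact inv_le_one_of_one_le₀ (one_le_sobolevWeight τ v.1)

lemma inclNegOne_apply (y : Ell2) (v : PuncturedLattice) : inclNegOne τ y v = y v := by
  change (toEll2 τ (-1)).symm (diagOp _ 1 _ _ y) v = _
  rw [toEll2_neg_one_symm_apply, diagOp_apply]
  have := sobolevWeight_ne_zero τ v.1
  field_simp

/-- The extension of `ad(a)` to a bounded operator `W_0(H) → W_{-1}(H)`. -/
noncomputable def adSobolev (θ : ℝ) (τ : ℂ) :
    SmoothNCTorus θ →ₗ[ℂ] SobolevH τ 0 →L[ℂ] SobolevH τ (-1) where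
  toFun a := inclNegOne τ ∘L adEll2 θ a ∘L
    (toEll2 τ 0).toContinuousLinearEquiv.toContinuousLinearMap
  map_add' a b := by
    rw [map_add, ContinuousLinearMap.add_comp, ContinuousLinearMap.comp_add]
  map_smul' c a := by
    rw [map_smul, ContinuousLinearMap.smul_comp, ContinuousLinearMap.comp_smul, RingHom.id_apply]

lemma adSobolev_apply (a : SmoothNCTorus θ) (x : SobolevH τ 0) (v : PuncturedLattice) :
    adSobolev θ τ a x v = adEll2 θ a (toEll2 τ 0 x) v :=
  inclNegOne_apply _ v

lemma hasSum_adSobolev_apply (a : SmoothNCTorus θ) (x : SobolevH τ 0) (v : PuncturedLattice) :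
    HasSum (fun u => a u * commPhase θ u v.1 * zeroExtend x (v.1 - u)) (adSobolev θ τ a x v) := by
  rw [adSobolev_apply, ← coe_toEll2_zero x]
  exact hasSum_adEll2_apply a _ v

lemma zeroExtend_ofSmooth {x : SmoothNCTorus θ} (hx : x ∈ traceZero θ) (s : ℤ) (v : ℤ × ℤ) :
    zeroExtend (SobolevH.ofSmooth τ s x) v = x v := by
  unfold zeroExtend
  split_ifs with h
  · rfl
  · rw [not_not] at h
    rw [h]
    exact (show x 0 = 0 from hx).symm

lemma isSobolevExtension_delta (θ : ℝ) (hτ : τ.im ≠ 0) :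
    IsSobolevExtension (delta θ τ) (deltaEquiv hτ).toContinuousLinearMap := by
  intro x hx
  refine ⟨?_, ?_⟩
  · change iota τ 0 * x 0 = 0
    rw [show x 0 = 0 from hx, mul_zero]
  · apply DFunLike.ext
    intro v
    exact deltaEquiv_apply hτ _ v

lemma isSobolevExtension_ad (τ : ℂ) (a : SmoothNCTorus θ) :
    IsSobolevExtension (ad a) (adSobolev θ τ a) := by
  intro x hx
  refine ⟨ad_apply_zero a x, ?_⟩
  apply DFunLike.ext
  intro v
  have h := hasSum_adSobolev_apply a (SobolevH.ofSmooth τ 0 x) v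
  simp only [zeroExtend_ofSmooth hx] at h
  exact h.unique (hasSum_ad_apply a x v.1)

lemma IsSobolevExtension.add {f g : SmoothNCTorus θ →ₗ[ℂ] SmoothNCTorus θ}
    {S T : SobolevH τ 0 →L[ℂ] SobolevH τ (-1)} (hf : IsSobolevExtension f S)
    (hg : IsSobolevExtension g T) : IsSobolevExtension (f + g) (S + T) := by
  intro x hx
  refine ⟨add_mem (hf x hx).1 (hg x hx).1, ?_⟩
  rw [add_apply, (hf x hx).2, (hg x hx).2]
  rfl

/-! ### The operator `δ_τ⁻¹ ad(a)` -/

/-- The operator `δ_τ⁻¹ ad(a)` on `W_0(H)`. -/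
noncomputable def deltaInvAd (hτ : τ.im ≠ 0) (a : SmoothNCTorus θ) :
    SobolevH τ 0 →L[ℂ] SobolevH τ 0 :=
  (deltaEquiv hτ).symm.toContinuousLinearMap ∘L adSobolev θ τ a

/-- This factorization reduces every question about `d_a` to `1 +` compact. -/
lemma deltaEquiv_comp_one_add (hτ : τ.im ≠ 0) (a : SmoothNCTorus θ) :
    (deltaEquiv hτ).toContinuousLinearMap ∘L (1 + deltaInvAd hτ a) =
      (deltaEquiv hτ).toContinuousLinearMap + adSobolev θ τ a := by
  ext1 x
  change deltaEquiv hτ (x + (deltaEquiv hτ).symm (adSobolev θ τ a x)) = _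
  rw [map_add, ContinuousLinearEquiv.apply_symm_apply]
  rfl

/-- On `ℓ²` the operator is the diagonal one with entries `iota⁻¹` after the bounded `ad(a)`. The
diagonal factor is a norm limit of finite rank operators, a property that survives composition with
bounded ones. -/
lemma exists_tendsto_sum_smulRight_deltaInvAd (hτ : τ.im ≠ 0) (a : SmoothNCTorus θ) :
    ∃ (φ : PuncturedLattice → SobolevH τ 0 →L[ℂ] ℂ) (u : PuncturedLattice → SobolevH τ 0),
      Tendsto (fun s : Finset PuncturedLattice => ∑ v ∈ s, (φ v).smulRight (u v)) atTop
        (𝓝 (deltaInvAd hτ a)) := by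
  classical
  obtain ⟨C, hC0, hC⟩ := exists_norm_iota_inv_le hτ
  have h := QuillenDet.tendsto_sum_smulRight_comp
    (tendsto_sum_smulRight_diagOp hC0 hC (tendsto_iota_inv hτ))
    (toEll2 τ 0).symm.toContinuousLinearEquiv.toContinuousLinearMap
    (adEll2 θ a ∘L (toEll2 τ 0).toContinuousLinearEquiv.toContinuousLinearMap)
  suffices deltaInvAd hτ a = (toEll2 τ 0).symm.toContinuousLinearEquiv.toContinuousLinearMap ∘L
      diagOp _ C hC0 hC ∘L
        adEll2 θ a ∘L (toEll2 τ 0).toContinuousLinearEquiv.toContinuousLinearMap by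
    rw [this]
    exact ⟨_, _, h⟩
  ext1 x
  refine (deltaEquiv hτ).injective ?_
  change deltaEquiv hτ ((deltaEquiv hτ).symm (adSobolev θ τ a x)) =
    deltaEquiv hτ ((toEll2 τ 0).symm (diagOp _ C hC0 hC (adEll2 θ a (toEll2 τ 0 x))))
  rw [ContinuousLinearEquiv.apply_symm_apply]
  apply DFunLike.ext
  intro v
  rw [deltaEquiv_apply, toEll2_zero_symm_apply, diagOp_apply, adSobolev_apply,
    mul_inv_cancel_left₀ (iota_ne_zero hτ v.2)]

/-! ### The Fréchet topology -/

lemma continuous_weighted (θ : ℝ) (k : ℕ) :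
    Continuous (SmoothNCTorus.weighted k : SmoothNCTorus θ → _) :=
  continuous_iff_le_induced.mpr (iInf_le _ k)

lemma continuous_coeff (θ : ℝ) (v : ℤ × ℤ) : Continuous fun a : SmoothNCTorus θ => a v := by
  have h := (lp.evalCLM ℂ (fun _ : ℤ × ℤ => ℂ) ⊤ v).continuous.comp (continuous_weighted θ 0)
  refine h.congr fun a => ?_
  change (size v ^ 0 : ℝ) • a v = a v
  rw [pow_zero, one_smul]

/-- The seminorm with exponent 4 controls the `ℓ¹` norm because `size⁻⁴` is summable. This makes `a
↦ ad(a)` continuous for the Fréchet topology. -/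
lemma tsum_norm_le (a b : SmoothNCTorus θ) :
    ∑' v, ‖(a - b) v‖ ≤ (∑' v : ℤ × ℤ, (size v ^ 4)⁻¹) *
      ‖SmoothNCTorus.weighted 4 a - SmoothNCTorus.weighted 4 b‖ := by
  rw [← tsum_mul_right]
  refine Summable.tsum_le_tsum (fun v => ?_) (summable_norm (a - b))
    (summable_size_inv.mul_right _)
  have h := lp.norm_apply_le_norm (p := ⊤) (by simp)
    (SmoothNCTorus.weighted 4 a - SmoothNCTorus.weighted 4 b) v
  have hs : 0 < size v ^ 4 := pow_pos (size_pos v) 4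
  have h1 : (SmoothNCTorus.weighted 4 a - SmoothNCTorus.weighted 4 b :
      lp (fun _ : ℤ × ℤ => ℂ) ⊤) v = (size v ^ 4 : ℝ) • (a - b) v := by
    change (size v ^ 4 : ℝ) • a v - (size v ^ 4 : ℝ) • b v = (size v ^ 4 : ℝ) • (a v - b v)
    rw [smul_sub]
  rw [h1, norm_smul, Real.norm_of_nonneg hs.le] at h
  rw [inv_mul_eq_div, le_div_iff₀ hs, mul_comm]
  exact h

lemma continuous_adEll2 (θ : ℝ) : Continuous (adEll2 θ) := by
  rw [continuous_iff_continuousAt]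
  intro b
  rw [ContinuousAt, tendsto_iff_norm_sub_tendsto_zero]
  have h1 : Tendsto (fun a : SmoothNCTorus θ => 2 * ((∑' v : ℤ × ℤ, (size v ^ 4)⁻¹) *
      ‖SmoothNCTorus.weighted 4 a - SmoothNCTorus.weighted 4 b‖)) (𝓝 b) (𝓝 0) := by
    have h2 := tendsto_iff_norm_sub_tendsto_zero.mp ((continuous_weighted θ 4).tendsto b)
    simpa using (h2.const_mul (∑' v : ℤ × ℤ, (size v ^ 4)⁻¹)).const_mul 2
  refine squeeze_zero (fun _ => norm_nonneg _) (fun a => ?_) h1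
  rw [← map_sub]
  exact (norm_adEll2_le _).trans (mul_le_mul_of_nonneg_left (tsum_norm_le a b) zero_le_two)

/-- The continuous linear map `a ↦ ad(a)` from `H` to the bounded operators
`W_0(H) → W_{-1}(H)`. -/
noncomputable def adSobolevL (θ : ℝ) (τ : ℂ) :
    traceZero θ →L[ℂ] SobolevH τ 0 →L[ℂ] SobolevH τ (-1) where
  toLinearMap := adSobolev θ τ ∘ₗ (traceZero θ).subtype
  cont := by
    have h : Continuous fun a : traceZero θ => adEll2 θ a.1 :=
      (continuous_adEll2 θ).comp continuous_subtype_val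
    exact continuous_const.clm_comp (h.clm_comp continuous_const)

end NCTorus

/-- `1 + tK = -t(-t⁻¹ - K)`. -/
lemma QuillenDet.neg_inv_mem_spectrum_iff {A : Type*} [Ring A] [Algebra ℂ A] (K : A) {t : ℂ}
    (ht : t ≠ 0) : -t⁻¹ ∈ spectrum ℂ K ↔ ¬ IsUnit (1 + t • K) := by
  rw [spectrum.mem_iff, not_iff_not]
  have h : 1 + t • K =
      Units.mk0 (-t) (neg_ne_zero.mpr ht) • (algebraMap ℂ A (-t⁻¹) - K) := by
    rw [Units.smul_mk0, Algebra.algebraMap_eq_smul_one, smul_sub, smul_smul, neg_mul_neg,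
      mul_inv_cancel₀ ht, one_smul, neg_smul, sub_neg_eq_add]
  rw [h]
  exact (isUnit_smul_iff _ _).symm

namespace NCTorus

variable {θ : ℝ} {τ : ℂ}

/-! ### Elliptic regularity -/

/-- Submultiplicativity of `size` splits the weight between `a`, whose weighted coefficients are
summable, and `x`. The 2 bounds the commutator phase. -/
lemma exists_size_pow_mul_norm_adSobolev_le (a : SmoothNCTorus θ) (x : SobolevH τ 0) {k : ℕ} {C : ℝ}
    (hC : ∀ v, size v ^ k * ‖zeroExtend x v‖ ≤ C) :
    ∃ D : ℝ, ∀ v : PuncturedLattice, size v.1 ^ k * ‖adSobolev θ τ a x v‖ ≤ D := by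
  refine ⟨∑' u, size u ^ k * ‖a u‖ * (2 * C), fun v => ?_⟩
  have h1 := (hasSum_adSobolev_apply a x v).mul_left ((size v.1 ^ k : ℝ) : ℂ)
  have hs : 0 < size v.1 ^ k := pow_pos (size_pos v.1) k
  have h2 : ‖((size v.1 ^ k : ℝ) : ℂ) * adSobolev θ τ a x v‖ =
      size v.1 ^ k * ‖adSobolev θ τ a x v‖ := by
    rw [norm_mul, Complex.norm_real, Real.norm_of_nonneg hs.le]
  rw [← h2, ← h1.tsum_eq]
  refine tsum_of_norm_bounded ((a.summable_weighted k).mul_right (2 * C)).hasSum fun u => ?_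
  rw [norm_mul, Complex.norm_real, Real.norm_of_nonneg hs.le, norm_mul, norm_mul]
  have h3 : size v.1 ^ k ≤ size u ^ k * size (v.1 - u) ^ k := by
    rw [← mul_pow]
    refine pow_le_pow_left₀ (size_pos v.1).le ?_ k
    simpa using size_add_le u (v.1 - u)
  have h4 := norm_commPhase_le θ u v.1
  have hu : 0 < size u ^ k := pow_pos (size_pos u) k
  have hvu : 0 < size (v.1 - u) ^ k := pow_pos (size_pos _) k
  calc size v.1 ^ k * (‖a u‖ * ‖commPhase θ u v.1‖ * ‖zeroExtend x (v.1 - u)‖)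
      ≤ (size u ^ k * size (v.1 - u) ^ k) * (‖a u‖ * 2 * ‖zeroExtend x (v.1 - u)‖) := by gcongr
    _ = size u ^ k * ‖a u‖ * (2 * (size (v.1 - u) ^ k * ‖zeroExtend x (v.1 - u)‖)) := by ring
    _ ≤ size u ^ k * ‖a u‖ * (2 * C) := by
      gcongr
      exact hC _

lemma sobolevH_add_apply {s : ℤ} (x y : SobolevH τ s) (v : PuncturedLattice) :
    (x + y) v = x v + y v := rfl

/-- Bootstrapping: in `δ_τ x = -ad(a) x` the right side decays as fast as `x`, and dividing by
`iota` gains one power of `size`. Square summability starts the induction. -/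
lemma zeroExtend_mem_rapidlyDecreasing (hτ : τ.im ≠ 0) {a : SmoothNCTorus θ} {x : SobolevH τ 0}
    (hx : deltaEquiv hτ x + adSobolev θ τ a x = 0) : zeroExtend x ∈ rapidlyDecreasing := by
  obtain ⟨c, hc0, hc⟩ := exists_size_le_norm_iota hτ
  intro k
  induction k with
  | zero =>
    refine ⟨‖toEll2 τ 0 x‖, fun v => ?_⟩
    rw [pow_zero, one_mul, ← coe_toEll2_zero x]
    exact norm_zeroExtend_le _ v
  | succ k ih =>
    obtain ⟨C, hC⟩ := ih
    obtain ⟨D, hD⟩ := exists_size_pow_mul_norm_adSobolev_le a x hC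
    refine ⟨max 0 (c * D), fun v => ?_⟩
    by_cases hv : v = 0
    · rw [hv, zeroExtend_zero, norm_zero, mul_zero]
      exact le_max_left _ _
    refine le_max_of_le_right ?_
    have h1 : iota τ v * x ⟨v, hv⟩ + adSobolev θ τ a x ⟨v, hv⟩ = 0 := by
      rw [← deltaEquiv_apply hτ x ⟨v, hv⟩, ← sobolevH_add_apply, hx]
      rfl
    have h2 : ‖iota τ v‖ * ‖x ⟨v, hv⟩‖ = ‖adSobolev θ τ a x ⟨v, hv⟩‖ := by
      rw [← norm_mul, eq_neg_of_add_eq_zero_left h1, norm_neg]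
    have h3 : zeroExtend x v = x ⟨v, hv⟩ := zeroExtend_coe x ⟨v, hv⟩
    have hs : 0 < size v ^ k := pow_pos (size_pos v) k
    rw [h3]
    calc size v ^ (k + 1) * ‖x ⟨v, hv⟩‖ = size v ^ k * (size v * ‖x ⟨v, hv⟩‖) := by ring
      _ ≤ size v ^ k * (c * ‖iota τ v‖ * ‖x ⟨v, hv⟩‖) := by
        gcongr
        exact hc v hv
      _ = c * (size v ^ k * (‖iota τ v‖ * ‖x ⟨v, hv⟩‖)) := by ring
      _ ≤ c * D := by
        rw [h2]
        gcongr
        exact hD ⟨v, hv⟩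

/-! ### The discriminant -/

lemma ofSmooth_eq_zero_iff {x : SmoothNCTorus θ} (hx : x ∈ traceZero θ) {s : ℤ} :
    SobolevH.ofSmooth τ s x = 0 ↔ x = 0 := by
  constructor
  · intro h
    ext v
    rw [← zeroExtend_ofSmooth hx s, h]
    unfold zeroExtend
    split_ifs <;> rfl
  · rintro rfl
    rfl

lemma isSobolevExtension_dOp (hτ : τ.im ≠ 0) (a : SmoothNCTorus θ) :
    IsSobolevExtension (dOp τ a) ((deltaEquiv hτ).toContinuousLinearMap + adSobolev θ τ a) :=
  (isSobolevExtension_delta θ hτ).add (isSobolevExtension_ad τ a)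

/-- The solutions of `d_a x = 0` in `W_0(H)` are smooth. -/
lemma injective_iff (hτ : τ.im ≠ 0) (a : SmoothNCTorus θ) :
    Function.Injective ((deltaEquiv hτ).toContinuousLinearMap + adSobolev θ τ a) ↔
      ∀ x ∈ traceZero θ, dOp τ a x = 0 → x = 0 := by
  have hext := isSobolevExtension_dOp hτ a
  rw [injective_iff_map_eq_zero]
  constructor
  · intro h x hx hdx
    rw [← ofSmooth_eq_zero_iff (τ := τ) (s := 0) hx]
    refine h _ ?_
    rw [(hext x hx).2, hdx]
    rfl
  · intro h x hx
    let y : SmoothNCTorus θ := ⟨zeroExtend x, zeroExtend_mem_rapidlyDecreasing hτ hx⟩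
    have hy : y ∈ traceZero θ := zeroExtend_zero x
    have hyx : SobolevH.ofSmooth τ 0 y = x := by
      apply DFunLike.ext
      intro v
      exact zeroExtend_coe x v
    have h1 : dOp τ a y = 0 := by
      rw [← ofSmooth_eq_zero_iff (τ := τ) (s := -1) (hext y hy).1, ← (hext y hy).2, hyx, hx]
    rw [← hyx, h y hy h1]
    rfl

variable (θ) in
/-- The unit of `A_θ`. -/
noncomputable def unit : SmoothNCTorus θ :=
  ⟨Pi.single 0 1, fun k => ⟨1, fun v => by
    by_cases h : v = 0
    · subst h
      simp [size]
    · simp [h]⟩⟩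

lemma unit_apply_zero : unit θ 0 = 1 := Pi.single_eq_same (M := fun _ : ℤ × ℤ => ℂ) 0 1

lemma unit_apply_of_ne {v : ℤ × ℤ} (hv : v ≠ 0) : unit θ v = 0 :=
  Pi.single_eq_of_ne (M := fun _ : ℤ × ℤ => ℂ) hv 1

lemma dOp_unit (τ : ℂ) (a : SmoothNCTorus θ) : dOp τ a (unit θ) = 0 := by
  ext v
  have h1 : delta θ τ (unit θ) v = 0 := by
    change iota τ v * unit θ v = 0
    by_cases hv : v = 0
    · simp [hv, iota]
    · rw [unit_apply_of_ne hv, mul_zero]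
  have h2 : ad a (unit θ) v = 0 := by
    refine (hasSum_ad_apply a (unit θ) v).unique ?_
    convert! hasSum_zero using 1
    funext u
    by_cases hu : v = u
    · rw [hu, commPhase_self, mul_zero, zero_mul]
    · rw [unit_apply_of_ne (sub_ne_zero.mpr hu), mul_zero]
  change delta θ τ (unit θ) v + ad a (unit θ) v = 0
  rw [h1, h2, add_zero]

/-- The unit lies in the kernel and has trace one, so subtracting `tr(x) · 1` moves a kernel vector
into `H`. Conversely, a generator of a one-dimensional kernel has nonzero trace, because the unit is
a multiple of it. -/
lemma one_lt_rank_ker_dOp_iff (τ : ℂ) (a : SmoothNCTorus θ) :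
    1 < Module.rank ℂ (LinearMap.ker (dOp τ a)) ↔
      ∃ x ∈ traceZero θ, dOp τ a x = 0 ∧ x ≠ 0 := by
  let e : LinearMap.ker (dOp τ a) := ⟨unit θ, dOp_unit τ a⟩
  constructor
  · contrapose!
    intro h
    rw [rank_le_one_iff]
    refine ⟨e, fun x => ⟨x.1 0, ?_⟩⟩
    rw [eq_comm, ← sub_eq_zero]
    refine Subtype.ext (h _ ?_ (x - x.1 0 • e).2)
    change x.1 0 + -(x.1 0 * unit θ 0) = 0
    rw [unit_apply_zero]
    ring
  · rintro ⟨x, hx, hdx, hx0⟩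
    by_contra h
    rw [not_lt, rank_le_one_iff] at h
    obtain ⟨z, hz⟩ := h
    obtain ⟨r, hr⟩ := hz e
    obtain ⟨s, hs⟩ := hz ⟨x, hdx⟩
    have h1 : r * z.1 0 = 1 := by
      rw [← unit_apply_zero (θ := θ)]
      exact DFunLike.congr_fun (congrArg Subtype.val hr) 0
    have h2 : s * z.1 0 = 0 := (DFunLike.congr_fun (congrArg Subtype.val hs) 0).trans hx
    have h3 : z.1 0 ≠ 0 := right_ne_zero_of_mul_eq_one h1
    have h4 : s = 0 := (mul_eq_zero.mp h2).resolve_right h3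
    rw [h4, zero_smul] at hs
    exact hx0 (congrArg Subtype.val hs).symm

lemma isFredholmZero_add_adSobolev (hτ : τ.im ≠ 0) (a : SmoothNCTorus θ) :
    QuillenDet.IsFredholmZero ((deltaEquiv hτ).toContinuousLinearMap + adSobolev θ τ a) := by
  obtain ⟨φ, u, h⟩ := exists_tendsto_sum_smulRight_deltaInvAd hτ a
  rw [← deltaEquiv_comp_one_add]
  exact QuillenDet.isFredholmZero_comp_one_add _ h

/-- Index zero identifies invertibility with injectivity, regularity moves kernel vectors into `H`,
and the unit accounts for the remaining dimension. -/
lemma mem_discriminant_iff (hτ : τ.im ≠ 0) (a : traceZero θ) :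
    a ∈ discriminant θ τ ↔
      ¬ ((deltaEquiv hτ).toContinuousLinearMap + adSobolev θ τ a.1).IsInvertible := by
  have h1 : ((deltaEquiv hτ).toContinuousLinearMap + adSobolev θ τ a.1).IsInvertible ↔
      Function.Injective ((deltaEquiv hτ).toContinuousLinearMap + adSobolev θ τ a.1) :=
    ⟨fun ⟨e, he⟩ => he ▸ e.injective, (isFredholmZero_add_adSobolev hτ a.1).isInvertible_of_injective⟩
  rw [h1, injective_iff]
  push Not
  exact one_lt_rank_ker_dOp_iff τ a.1

lemma smul_mem_discriminant_iff (hτ : τ.im ≠ 0) (a : traceZero θ) (t : ℂ) :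
    t • a ∈ discriminant θ τ ↔ ¬ IsUnit (1 + t • deltaInvAd hτ a.1) := by
  have h1 : adSobolev θ τ (t • a : traceZero θ).1 = t • adSobolev θ τ a.1 := map_smul _ t a.1
  have h2 : deltaInvAd hτ (t • a : traceZero θ).1 = t • deltaInvAd hτ a.1 := by
    rw [deltaInvAd, h1, ContinuousLinearMap.comp_smul, deltaInvAd]
  rw [mem_discriminant_iff hτ, ← deltaEquiv_comp_one_add, h2,
    QuillenDet.isUnit_iff_isInvertible, ContinuousLinearMap.isInvertible_equiv_comp]

lemma zero_notMem_discriminant (hτ : τ.im ≠ 0) : (0 : traceZero θ) ∉ discriminant θ τ := by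
  rw [mem_discriminant_iff hτ, not_not]
  exact ⟨deltaEquiv hτ, ((congrArg _ (map_zero (adSobolev θ τ))).trans (add_zero _)).symm⟩

lemma smul_mem_discriminant_iff_mem_spectrum (hτ : τ.im ≠ 0) (a : traceZero θ) {t : ℂ}
    (ht : t ≠ 0) :
    t • a ∈ discriminant θ τ ↔ -t⁻¹ ∈ spectrum ℂ (deltaInvAd hτ a.1) := by
  rw [smul_mem_discriminant_iff hτ]
  exact (QuillenDet.neg_inv_mem_spectrum_iff (deltaInvAd hτ a.1) ht).symm

/-- A nonzero coefficient of `a` yields a continuous coordinate on the line, so an accumulation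
point would give an accumulation of parameters `t` at which `1 + tK` is not invertible. -/
lemma not_accPt_discriminant_inter_span (hτ : τ.im ≠ 0) {a : traceZero θ} (ha : a ≠ 0)
    {y : traceZero θ} (hy : y ∈ ℂ ∙ a) :
    ¬ AccPt y (𝓟 (discriminant θ τ ∩ (ℂ ∙ a : Submodule ℂ (traceZero θ)))) := by
  obtain ⟨v, hv⟩ : ∃ v, a.1 v ≠ 0 := by
    by_contra! h
    exact ha (Subtype.ext (SmoothNCTorus.ext h))
  let f : traceZero θ → ℂ := fun b => b.1 v / a.1 v
  have hf : Continuous f := ((continuous_coeff θ v).comp continuous_subtype_val).div_const _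
  have hfa : ∀ b ∈ ℂ ∙ a, f b • a = b := by
    intro b hb
    obtain ⟨c, rfl⟩ := Submodule.mem_span_singleton.mp hb
    congr 1
    exact mul_div_cancel_right₀ c hv
  obtain ⟨φ, u, hK⟩ := exists_tendsto_sum_smulRight_deltaInvAd hτ a.1
  have h1 := QuillenDet.eventually_isUnit_one_add_smul hK (f y)
  rw [eventually_nhdsWithin_iff] at h1
  rw [accPt_iff_frequently, not_frequently]
  filter_upwards [hf.continuousAt.eventually h1] with b hb ⟨hby, hbΘ, hbℓ⟩
  have h2 : f b ≠ f y := fun h => hby (by rw [← hfa b hbℓ, h, hfa y hy])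
  rw [← hfa b hbℓ, smul_mem_discriminant_iff hτ] at hbΘ
  exact hbΘ (hb h2)

/-! ### The determinant line bundle over `H` -/

/-- The family `a ↦ d_a` of Fredholm operators. -/
noncomputable def fredholmFamily (θ : ℝ) (hτ : τ.im ≠ 0) (a : traceZero θ) :
    QuillenDet.FredholmZero (SobolevH τ 0) (SobolevH τ (-1)) :=
  ⟨(deltaEquiv hτ).toContinuousLinearMap + adSobolevL θ τ a, isFredholmZero_add_adSobolev hτ a.1⟩

lemma differentiable_fredholmFamily (θ : ℝ) (hτ : τ.im ≠ 0) :
    Differentiable ℂ fun a => (fredholmFamily θ hτ a).1 := by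
  have h : (fun a => (fredholmFamily θ hτ a).1) =
      fun a => (deltaEquiv hτ).toContinuousLinearMap + adSobolevL θ τ a := rfl
  rw [h]
  intro a
  have h1 := QuillenDet.hasFDerivAt_const_add_clm (deltaEquiv hτ).toContinuousLinearMap
    (adSobolevL θ τ) a
  have h2 := h1.differentiableAt
  exact h2

lemma isHolomorphicPullback_fredholmFamily (θ : ℝ) (hτ : τ.im ≠ 0) :
    QuillenDet.IsHolomorphicPullback (QuillenDet.detLineBundle _ _) (fredholmFamily θ hτ) := by
  refine ⟨(continuous_const.add (adSobolevL θ τ).continuous).subtype_mk _, fun A B => ?_⟩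
  refine (QuillenDet.differentiableOn_comp_const_add_clm (QuillenDet.differentiableOn_transition A B)
    (deltaEquiv hτ).toContinuousLinearMap (adSobolevL θ τ)).congr fun a ha => ?_
  exact (QuillenDet.isDeterminantLineBundle_detLineBundle.coordChange_eq A B _ ha 1).trans
    (mul_one _)

lemma isHolomorphicSection_canonicalSection (θ : ℝ) (hτ : τ.im ≠ 0) :
    QuillenDet.IsHolomorphicSection (QuillenDet.detLineBundle _ _) (fredholmFamily θ hτ)
      fun a => QuillenDet.canonicalSection (fredholmFamily θ hτ a) := by
  intro A
  refine (QuillenDet.differentiableOn_comp_const_add_clm (QuillenDet.differentiableOn_localSection A)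
    (deltaEquiv hτ).toContinuousLinearMap (adSobolevL θ τ)).congr fun a ha => ?_
  exact QuillenDet.isCanonicalSection_canonicalSection A _ ha

end NCTorus

/-! ### Assembly of the main theorem -/

open NCTorus QuillenDet in
theorem mainTheorem7 (θ : ℝ) (τ : ℂ) (hτ : τ.im ≠ 0) :
    ∃ (δ : SobolevH τ 0 ≃L[ℂ] SobolevH τ (-1))
      (adW : traceZero θ → SobolevH τ 0 →L[ℂ] SobolevH τ (-1)),
      -- `δ` and `adW a` are the extensions of `δ_τ` and `ad(a)`
      IsSobolevExtension (delta θ τ) δ.toContinuousLinearMap ∧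
      (∀ a : traceZero θ, IsSobolevExtension (ad a.1) (adW a)) ∧
      -- (i) `d` is the map `a ↦ d_a`, `σ` the canonical section of the determinant line bundle `L`
      (∃ (d : traceZero θ → FredholmZero (SobolevH τ 0) (SobolevH τ (-1)))
        (L : VectorBundleCore ℂ (FredholmZero (SobolevH τ 0) (SobolevH τ (-1))) ℂ
          (TraceClass (SobolevH τ 0) (SobolevH τ (-1))))
        (σ : ∀ T, L.Fiber T),
        (∀ a : traceZero θ, IsSobolevExtension (dOp τ a.1) (d a).1) ∧
        Differentiable ℂ (fun a => (d a).1) ∧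
        IsDeterminantLineBundle L ∧
        (∀ A B : TraceClass (SobolevH τ 0) (SobolevH τ (-1)),
          DifferentiableOn ℂ (transition A B)
            {T | (T + A.1).IsInvertible ∧ (T + B.1).IsInvertible}) ∧
        IsCanonicalSection L σ ∧
        (∀ A : TraceClass (SobolevH τ 0) (SobolevH τ (-1)),
          DifferentiableOn ℂ (localSection A) {T | (T + A.1).IsInvertible}) ∧
        IsHolomorphicPullback L d ∧
        IsHolomorphicSection L d (fun a => σ (d a)) ∧
        discriminant θ τ = {a | σ (d a) = 0}) ∧
      -- (ii) the intersection with a line is discrete and does not contain the origin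
      (∀ ℓ : Submodule ℂ (traceZero θ), Module.finrank ℂ ℓ = 1 →
        discriminant θ τ ∩ ℓ ⊆ (ℓ : Set (traceZero θ)) \ {0} ∧
        ∀ y ∈ ℓ, ¬ AccPt y (𝓟 (discriminant θ τ ∩ ℓ))) ∧
      -- the spectral description of the intersection with a line
      (∀ a : traceZero θ,
        IsCompactOperator (δ.symm.toContinuousLinearMap ∘L adW a) ∧
        ∀ t : ℂ, t ≠ 0 → (t • a ∈ discriminant θ τ ↔
          -t⁻¹ ∈ spectrum ℂ (δ.symm.toContinuousLinearMap ∘L adW a))) := by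
  refine ⟨deltaEquiv hτ, fun a => adSobolev θ τ a.1, isSobolevExtension_delta θ hτ,
    fun a => isSobolevExtension_ad τ a.1,
    ⟨fredholmFamily θ hτ, detLineBundle _ _, canonicalSection, fun a => ?_,
      differentiable_fredholmFamily θ hτ, isDeterminantLineBundle_detLineBundle, differentiableOn_transition,
      isCanonicalSection_canonicalSection, differentiableOn_localSection,
      isHolomorphicPullback_fredholmFamily θ hτ, isHolomorphicSection_canonicalSection θ hτ, ?_⟩,
    fun ℓ hℓ => ?_, fun a => ⟨?_, fun t ht => smul_mem_discriminant_iff_mem_spectrum hτ a ht⟩⟩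
  · exact isSobolevExtension_dOp hτ a.1
  · ext a
    rw [Set.mem_ofPred_eq, canonicalSection_eq_zero_iff]
    exact mem_discriminant_iff hτ a
  · obtain ⟨a, ha, rfl⟩ : ∃ a : traceZero θ, a ≠ 0 ∧ ℓ = ℂ ∙ a := by
      obtain ⟨a, ha, h⟩ := finrank_eq_one_iff'.mp hℓ
      refine ⟨a, fun h0 => ha (Subtype.ext h0), le_antisymm (fun b hb => ?_) ?_⟩
      · obtain ⟨c, hc⟩ := h ⟨b, hb⟩
        exact Submodule.mem_span_singleton.mpr ⟨c, congrArg Subtype.val hc⟩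
      · rw [Submodule.span_singleton_le_iff_mem]
        exact a.2
    refine ⟨fun b hb => ⟨hb.2, ?_⟩, fun y hy => not_accPt_discriminant_inter_span hτ ha hy⟩
    rintro rfl
    exact zero_notMem_discriminant hτ hb.1
  · obtain ⟨φ, u, h⟩ := exists_tendsto_sum_smulRight_deltaInvAd hτ a.1
    exact isCompactOperator_of_tendsto_sum_smulRight h
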